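/- Let $\kappa,\nu,N\ge 0$ be integers, $M=N+\nu$, $\alpha>0$, let $q_1,\dots,q_M>0$ be pairwise distinct, let $\delta_1,\dots,\delta_N\ge 0$ be pairwise distinct, and suppose $\alpha q_i-\delta_j>0$ for all $i,j$. Write $I_\kappa,K_\kappa$ for the modified Bessel functions of the first and second kind, $\Delta_n(x)=\prod_{1\le j<k\le n}(x_k-x_j)$, $$\psi_j(y)=y^{\kappa/2}I_\kappa\big(2\sqrt{\delta_j y}\big),\qquad \varphi_i(y)=\Big(\frac{q_i}{\alpha y}\Big)^{\kappa/2}K_\kappa\big(2\sqrt{\alpha q_i y}\big),$$ $$Z=(N!)^2(-\alpha)^{N\nu+N(N-1)/2}\,\alpha^{-N\kappa}\,\frac{\Delta_M(q)\,\Delta_N(\delta)\prod_{j=1}^N\delta_j^{\kappa/2}}{\prod_{i=1}^M\prod_{j=1}^N(\alpha q_i-\delta_j)},$$ and consider on $(0,\infty)^N$ the density $$P(y_1,\dots,y_N)=\frac{2^N N!}{Z}\det[\psi_i(y_j)]_{i,j=1}^N\,\det\big[1,q_i,\dots,q_i^{\nu-1},\varphi_i(y_1),\dots,\varphi_i(y_N)\big]_{i=1}^M$$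 (if $\kappa>0$ and some $\delta_j=0$, where this reads $0/0$, $P$ is the limit of this expression as $\delta$ is approached through positive parameters). Let $\gamma_\delta$ and $\gamma_q$ be closed piecewise continuously differentiable contours in $\mathbb C$ that do not intersect each other, such that $\gamma_\delta$ encircles each of $\delta_1,\dots,\delta_N$ once counter-clockwise, and $\gamma_q$ lies in $\mathbb C\setminus(-\infty,0]$ (so that it excludes the origin) and encircles each of $\alpha q_1,\dots,\alpha q_M$ once counter-clockwise. For $y_1,y_2>0$ put $$K_N(y_1,y_2)=2\oint_{\gamma_\delta}\frac{d\eta}{2\pi i}\oint_{\gamma_q}\frac{d\zeta}{2\pi i}\,\Big(\frac{\zeta}{\eta}\Big)^{\kappa/2}\,\frac{I_\kappa(2\sqrt{\eta y_1})\,K_\kappa(2\sqrt{\zeta y_2})}{\eta-\zeta}\,\prod_{l=1}^N\frac{\zeta-\delta_l}{\eta-\delta_l}\,\prod_{l=1}^M\frac{\eta-\alpha q_l}{\zeta-\alpha q_l},$$ where $(\zeta/\eta)^{\kappa/2}$ means $\zeta^{\kappa/2}/\eta^{\kappa/2}$ and powers and roots are principal (the function $\eta^{-\kappa/2}I_\kappa(2\sqrt{\eta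 y_1})$ extends to an entire function of $\eta$). Then the double integral converges absolutely, and $K_N$ is a correlation kernel of the ensemble with density $P$: for all $0\le k\le N$ and all $y_1,\dots,y_k>0$, the function $(y_{k+1},\dots,y_N)\mapsto P(y_1,\dots,y_N)$ is integrable on $(0,\infty)^{N-k}$, and $$\frac{N!}{(N-k)!}\int_{(0,\infty)^{N-k}}P(y_1,\dots,y_N)\,dy_{k+1}\cdots dy_N=\det\big[K_N(y_i,y_j)\big]_{i,j=1}^k .$$ In particular $P(y_1,\dots,y_N)=\frac1{N!}\det[K_N(y_i,y_j)]_{i,j=1}^N$. -/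

import Mathlib

open Set Filter Topology MeasureTheory
open scoped Nat

noncomputable section

/-! ### Modified Bessel functions of integer order -/

/-- The modified Bessel function of the first kind `I_κ(z)` of order `κ = 0, 1, 2, …`. -/
def besselI (κ : ℕ) (z : ℂ) : ℂ :=
  ∑' m : ℕ, (z / 2) ^ (2 * m + κ) / ((m ! : ℂ) * ((m + κ)! : ℂ))

/-- The modified Bessel function of the second kind `K_κ(z)`, through its integral representation
in the half plane `Re z > 0`. It is used only there: as a function of `ζ` in `ℂ \ (-∞, 0]` and
`y > 0`, the argument `2 √(ζ y)` (principal branch) has positive real part. -/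
def besselK (κ : ℕ) (z : ℂ) : ℂ :=
  ∫ t in Ioi (0 : ℝ), Complex.exp (-z * (Real.cosh t : ℂ)) * (Real.cosh (κ * t) : ℂ)

/-- `I_κ` on the real line, where its values are real. -/
def besselIReal (κ : ℕ) (x : ℝ) : ℝ := (besselI κ (x : ℂ)).re

/-- `K_κ` on the positive real half line, where its values are real. -/
def besselKReal (κ : ℕ) (x : ℝ) : ℝ := (besselK κ (x : ℂ)).re

/-! ### The biorthogonal ensemble -/

/-- The Vandermonde determinant `∏_{j < k} (x_k - x_j)`. -/
def vandermondeProd {n : ℕ} (x : Fin n → ℝ) : ℝ :=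
  ∏ j : Fin n, ∏ k ∈ Finset.Ioi j, (x k - x j)

/-- `ψ(y) = y^{κ/2} I_κ(2 √(d y))`, with parameter `d = δ_j`. -/
def psiFun (κ : ℕ) (d y : ℝ) : ℝ :=
  y ^ ((κ : ℝ) / 2) * besselIReal κ (2 * √(d * y))

/-- `φ(y) = (p / (α y))^{κ/2} K_κ(2 √(α p y))`, with parameter `p = q_i`. -/
def phiFun (κ : ℕ) (α p y : ℝ) : ℝ :=
  (p / (α * y)) ^ ((κ : ℝ) / 2) * besselKReal κ (2 * √(α * p * y))

/-- The normalising constant `Z`, with `M = ν + N`. -/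
def normConst (κ ν N : ℕ) (α : ℝ) (q : Fin (ν + N) → ℝ) (δ : Fin N → ℝ) : ℝ :=
  (N ! : ℝ) ^ 2 * (-α) ^ (N * ν + N * (N - 1) / 2) / α ^ (N * κ) *
    (vandermondeProd q * vandermondeProd δ * ∏ j, δ j ^ ((κ : ℝ) / 2)) /
      ∏ i, ∏ j, (α * q i - δ j)

/-- The density
`(2^N N! / Z) det[ψ_i(y_j)]_{i,j=1}^N det[1, q_i, …, q_i^{ν-1}, φ_i(y_1), …, φ_i(y_N)]_{i=1}^M`. -/
def densityFormula (κ ν N : ℕ) (α : ℝ) (q : Fin (ν + N) → ℝ) (δ : Fin N → ℝ)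
    (y : Fin N → ℝ) : ℝ :=
  2 ^ N * (N ! : ℝ) / normConst κ ν N α q δ *
    (Matrix.of fun i j : Fin N => psiFun κ (δ i) (y j)).det *
    (Matrix.of fun i c : Fin (ν + N) =>
      Fin.append (fun k : Fin ν => q i ^ (k : ℕ))
        (fun j : Fin N => phiFun κ α (q i) (y j)) c).det

open Classical in
/-- The joint density of the ensemble. If `κ > 0` and one of the `δ_j` vanishes, both `Z` and
`det[ψ_i(y_j)]` are zero, and the density is the limit of the formula as the parameter tends to
`δ` through positive values. -/
def jointDensity (κ ν N : ℕ) (α : ℝ) (q : Fin (ν + N) → ℝ) (δ : Fin N → ℝ)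
    (y : Fin N → ℝ) : ℝ :=
  if κ = 0 ∨ ∀ j, 0 < δ j then densityFormula κ ν N α q δ y
  else limUnder (𝓝[{δ' : Fin N → ℝ | ∀ j, 0 < δ' j}] δ)
    (fun δ' => densityFormula κ ν N α q δ' y)

/-! ### Correlation functions and correlation kernels on `(0, ∞)` -/

/-- `P(y_1, …, y_k, z_1, …, z_{N-k})` -/
def densitySection {N : ℕ} (P : (Fin N → ℝ) → ℝ) (k : ℕ) (hk : k ≤ N) (y : Fin k → ℝ)
    (z : Fin (N - k) → ℝ) : ℝ :=
  P fun i => Fin.append y z (Fin.cast (Nat.add_sub_of_le hk).symm i)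

/-- The `k`-point correlation function
`ρ_k(y_1, …, y_k) = N! / (N-k)! ∫_{(0,∞)^{N-k}} P(y_1, …, y_N) dy_{k+1} ⋯ dy_N`. -/
def correlationFunction {N : ℕ} (P : (Fin N → ℝ) → ℝ) (k : ℕ) (hk : k ≤ N)
    (y : Fin k → ℝ) : ℝ :=
  (N ! : ℝ) / ((N - k)! : ℝ) *
    ∫ z in Set.univ.pi (fun _ : Fin (N - k) => Ioi (0 : ℝ)), densitySection P k hk y z

/-- `K` is a correlation kernel of the point process on `(0, ∞)` with joint density `P`: all
`k`-point functions exist and `ρ_k(y_1, …, y_k) = det[K(y_i, y_j)]`. The case `k = N` is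
`P = det[K(y_i, y_j)] / N!`, and `k = 0` says that `P` has total integral one. -/
def IsCorrelationKernel {N : ℕ} (P : (Fin N → ℝ) → ℝ) (K : ℝ → ℝ → ℂ) : Prop :=
  ∀ (k : ℕ) (hk : k ≤ N) (y : Fin k → ℝ), (∀ i, 0 < y i) →
    IntegrableOn (densitySection P k hk y) (Set.univ.pi fun _ : Fin (N - k) => Ioi (0 : ℝ)) ∧
    (correlationFunction P k hk y : ℂ) = (Matrix.of fun i j : Fin k => K (y i) (y j)).det

/-! ### Contours -/

/-- `γ`, restricted to `[0, 1]`, is a closed piecewise continuously differentiable curve. -/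
structure IsClosedContour (γ : ℝ → ℂ) : Prop where
  continuousOn : ContinuousOn γ (Icc 0 1)
  closed : γ 0 = γ 1
  piecewise : ∃ (S : Finset ℝ) (C : ℝ), ∀ t ∈ Ioo (0 : ℝ) 1, t ∉ S →
    DifferentiableAt ℝ γ t ∧ ContinuousAt (deriv γ) t ∧ ‖deriv γ t‖ ≤ C

/-- The points of the contour. -/
def contourImage (γ : ℝ → ℂ) : Set ℂ := γ '' Icc 0 1

/-- `∮_γ f(z) dz` -/
def contourIntegral (f : ℂ → ℂ) (γ : ℝ → ℂ) : ℂ :=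
  ∫ t in (0 : ℝ)..1, f (γ t) * deriv γ t

/-- The winding number of `γ` about `a`. -/
def windingNumber (γ : ℝ → ℂ) (a : ℂ) : ℂ :=
  contourIntegral (fun z => (z - a)⁻¹) γ / (2 * Real.pi * Complex.I)

/-- `γ` encircles `a` (once) in counter-clockwise direction. -/
def Encircles (γ : ℝ → ℂ) (a : ℂ) : Prop :=
  a ∉ contourImage γ ∧ windingNumber γ a = 1

/-! ### The double contour integral -/

/-- The integrand
`(ζ/η)^{κ/2} I_κ(2√(η y₁)) K_κ(2√(ζ y₂)) / (η - ζ) ∏ (ζ - δ_l)/(η - δ_l) ∏ (η - α q_l)/(ζ - α q_l)`,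
where `(ζ/η)^{κ/2}` means `ζ^{κ/2} / η^{κ/2}` and all powers and roots are principal. The sign of
the root of `η` cancels in `η^{-κ/2} I_κ(2√(η y₁))`, so that the integrand is analytic across
the negative `η` axis. -/
def kernelIntegrand (κ ν N : ℕ) (α : ℝ) (q : Fin (ν + N) → ℝ) (δ : Fin N → ℝ)
    (y₁ y₂ : ℝ) (η ζ : ℂ) : ℂ :=
  ζ ^ ((κ : ℂ) / 2) / η ^ ((κ : ℂ) / 2) *
    (besselI κ (2 * (η * y₁) ^ (1 / 2 : ℂ)) * besselK κ (2 * (ζ * y₂) ^ (1 / 2 : ℂ)) / (η - ζ)) *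
    (∏ l, (ζ - δ l) / (η - δ l)) *
    ∏ l, (η - α * q l) / (ζ - α * q l)

/-- `2 ∮_{γδ} dη/(2πi) ∮_{γq} dζ/(2πi)` of the integrand above. -/
def contourKernel (κ ν N : ℕ) (α : ℝ) (q : Fin (ν + N) → ℝ) (δ : Fin N → ℝ)
    (γδ γq : ℝ → ℂ) (y₁ y₂ : ℝ) : ℂ :=
  2 * (contourIntegral (fun η =>
    contourIntegral (fun ζ => kernelIntegrand κ ν N α q δ y₁ y₂ η ζ) γq
      / (2 * Real.pi * Complex.I)) γδ / (2 * Real.pi * Complex.I))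

end

/-! ### Determinantal ensembles with a reproducing kernel -/

/-! The density is that of a biorthogonal ensemble. Expanding `I_κ` in its power series and
integrating term by term against `K_κ` leaves a geometric series, so the pairing of `psiRegular` at
δ_j with `phiFun` at q_i is (2 α^κ)⁻¹ / (α q_i - δ_j), a Cauchy matrix
(`integrableOn_psiRegular_mul_phiFun`). Lagrange interpolation at the nodes α q_i yields explicit
coefficients, `biorthCoeff`, that invert the Cauchy columns and annihilate the monomial columns
q_i^k, k < ν. The resulting combinations `chiFun` of the φ_i are biorthonormal to the `psiRegular`.
By `det_powAppend_eq_mul_det` the second determinant in the density is, up to a power of 2 α^κ, a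
Cauchy–Vandermonde determinant times det[χ_i(y_j)]. That Cauchy–Vandermonde determinant cancels
against Z, whence P = det[K(y_i, y_j)] / N! with K(x, y) = ∑ ψ_j(x) χ_j(y)
(`densityRegular_eq_kernelDet`).

Biorthonormality makes K reproduce itself under integration and have trace N. Integrating one point
out of an (n+1)-point determinant therefore gives N - n times the n-point one, and iteration gives
the correlation functions (`integral_kernelDet`).

The double contour integral is evaluated by residues. The poles ζ = α q_i and η = δ_j produce
exactly the coefficients `biorthCoeff`. The pole ζ = η leaves a function without poles at the δ_j,
whose integral over γδ vanishes (`contourIntegral_contourIntegral_eq_sum`). So the contour kernel is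
K conjugated by y^{κ/2}, which does not change determinants (`contourKernel_eq`).

Vanishing δ_j are covered because the factor ∏ δ_j^{κ/2} cancels between numerator and Z; what
remains, `densityRegular`, is continuous in δ. -/

theorem det_bordered {ι : Type*} [Fintype ι] [DecidableEq ι] (M : Matrix ι ι ℝ) (u v : ι → ℝ)
    (c : ℝ) :
    (Matrix.fromBlocks M (Matrix.of fun i (_ : Unit) => u i) (Matrix.of fun (_ : Unit) j => v j)
      (Matrix.of fun _ _ => c)).det = c * M.det - ∑ i, ∑ j, M.adjugate j i * (u i * v j) := by
  have key : ∀ A : Matrix ι ι ℝ, A.det ≠ 0 →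
      (Matrix.fromBlocks A (Matrix.of fun i (_ : Unit) => u i) (Matrix.of fun (_ : Unit) j => v j)
      (Matrix.of fun _ _ => c)).det = c * A.det - ∑ i, ∑ j, A.adjugate j i * (u i * v j) := by
    intro A hA
    -- For invertible `A` this is the Schur complement formula.
    let _ := A.invertibleOfIsUnitDet (isUnit_iff_ne_zero.2 hA)
    rw [Matrix.det_fromBlocks₁₁, Matrix.invOf_eq_nonsing_inv, Matrix.inv_def,
      Ring.inverse_eq_inv', Matrix.det_unique (n := Unit)]
    simp only [Matrix.sub_apply, Matrix.of_apply, Matrix.mul_apply, Matrix.smul_apply, smul_eq_mul]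
    rw [mul_sub, mul_comm c, Finset.mul_sum]
    congr 1
    refine Finset.sum_congr rfl fun i _ => ?_
    rw [Finset.sum_mul, Finset.mul_sum]
    refine Finset.sum_congr rfl fun j _ => ?_
    field_simp
  -- The singular shifts M + t·1 are roots of the characteristic polynomial of -M, hence finitely
  -- many; both sides are continuous in `t`, so the identity extends from the dense complement to t
  -- = 0.
  have hfin : {t : ℝ | (M + t • (1 : Matrix ι ι ℝ)).det = 0}.Finite := by
    refine ((-M).charpoly.rootSet_finite ℝ).subset fun t (ht : _ = _) => ?_
    rw [Polynomial.mem_rootSet]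
    refine ⟨(Matrix.charpoly_monic _).ne_zero, ?_⟩
    rw [Polynomial.coe_aeval_eq_eval, Matrix.eval_charpoly]
    convert ht using 2
    rw [sub_neg_eq_add, add_comm, Matrix.smul_one_eq_diagonal]
    rfl
  have h := Continuous.ext_on (hfin.countable.dense_compl ℝ)
    (f := fun t : ℝ => (Matrix.fromBlocks (M + t • (1 : Matrix ι ι ℝ))
      (Matrix.of fun i (_ : Unit) => u i) (Matrix.of fun (_ : Unit) j => v j)
      (Matrix.of fun _ _ => c)).det)
    (g := fun t : ℝ => c * (M + t • (1 : Matrix ι ι ℝ)).det -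
      ∑ i, ∑ j, (M + t • (1 : Matrix ι ι ℝ)).adjugate j i * (u i * v j))
    (Continuous.matrix_det (Continuous.matrix_fromBlocks (by fun_prop) continuous_const
      continuous_const continuous_const))
    (by
      have hM : Continuous fun t : ℝ => M + t • (1 : Matrix ι ι ℝ) := by fun_prop
      refine (continuous_const.mul hM.matrix_det).sub ?_
      refine continuous_finsetSum _ fun i _ => continuous_finsetSum _ fun j _ => ?_
      exact (hM.matrix_adjugate.matrix_elem j i).mul continuous_const)
    (fun t ht => key _ ht)
  simpa using congrFun h 0

section Determinantal

variable {X : Type*}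

/-- The kernel `∑ ψ_i(x) χ_i(y)`. -/
def sumKernel {N : ℕ} (ψ χ : Fin N → X → ℝ) (x y : X) : ℝ := ∑ i, ψ i x * χ i y

/-- `det[K(w_a, w_b)]` for a finite family of points `w`. -/
def kernelDet {N : ℕ} (ψ χ : Fin N → X → ℝ) {ι : Type*} [Fintype ι] [DecidableEq ι]
    (w : ι → X) : ℝ := (Matrix.of fun a b => sumKernel ψ χ (w a) (w b)).det

theorem kernelDet_comp_equiv {N : ℕ} (ψ χ : Fin N → X → ℝ) {ι ι' : Type*} [Fintype ι]
    [DecidableEq ι] [Fintype ι'] [DecidableEq ι'] (e : ι' ≃ ι) (w : ι → X) :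
    kernelDet ψ χ (w ∘ e) = kernelDet ψ χ w := by
  unfold kernelDet
  rw [← Matrix.det_submatrix_equiv_self e]
  rfl

theorem kernelDet_sum_unit {N : ℕ} (ψ χ : Fin N → X → ℝ) {ι : Type*} [Fintype ι]
    [DecidableEq ι] (y : ι → X) (z : X) :
    kernelDet ψ χ (Sum.elim y fun _ : Unit => z) =
      sumKernel ψ χ z z * kernelDet ψ χ y -
        ∑ i, ∑ j, (Matrix.of fun a b => sumKernel ψ χ (y a) (y b)).adjugate j i *
          (sumKernel ψ χ (y i) z * sumKernel ψ χ z (y j)) := by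
  unfold kernelDet
  rw [← det_bordered]
  congr 1
  ext (a | a) (b | b) <;> rfl

theorem sumKernel_mul_sumKernel {N : ℕ} {ψ χ : Fin N → X → ℝ} (x z y : X) :
    sumKernel ψ χ x z * sumKernel ψ χ z y =
      ∑ i, ∑ j, ψ i x * χ j y * (ψ j z * χ i z) := by
  unfold sumKernel
  rw [Finset.sum_mul_sum]
  exact Finset.sum_congr rfl fun i _ => Finset.sum_congr rfl fun j _ => by ring

/-- Reindexing the ψ-factors by σ collects everything that depends on one point into one factor.
Each summand is then a product of one-variable functions, which is what integrability over a product
measure needs. -/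
theorem kernelDet_eq_sum {N : ℕ} {ψ χ : Fin N → X → ℝ} {ι : Type*} [Fintype ι] [DecidableEq ι] (w : ι → X) :
    kernelDet ψ χ w = ∑ σ : Equiv.Perm ι, ∑ f : ι → Fin N,
      ((Equiv.Perm.sign σ : ℤ) : ℝ) * ∏ a, ψ (f (σ.symm a)) (w a) * χ (f a) (w a) := by
  unfold kernelDet sumKernel
  rw [Matrix.det_apply']
  refine Finset.sum_congr rfl fun σ _ => ?_
  simp only [Matrix.of_apply]
  rw [Finset.prod_univ_sum, Finset.mul_sum, Fintype.piFinset_univ]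
  refine Finset.sum_congr rfl fun f _ => ?_
  rw [Finset.prod_mul_distrib, Finset.prod_mul_distrib,
    ← Equiv.prod_comp σ fun a => ψ (f (σ.symm a)) (w a)]
  simp

variable [MeasurableSpace X] {μ : Measure X} {N : ℕ} {ψ χ : Fin N → X → ℝ}

theorem integrable_sumKernel_self (hint : ∀ i j, Integrable (fun x => ψ i x * χ j x) μ) :
    Integrable (fun z => sumKernel ψ χ z z) μ :=
  integrable_finsetSum _ fun i _ => hint i i

theorem integral_sumKernel_self (hint : ∀ i j, Integrable (fun x => ψ i x * χ j x) μ)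
    (horth : ∀ i j, ∫ x, ψ i x * χ j x ∂μ = if i = j then 1 else 0) :
    ∫ z, sumKernel ψ χ z z ∂μ = N := by
  unfold sumKernel
  rw [integral_finsetSum _ fun i _ => hint i i]
  simp [horth]

theorem integrable_sumKernel_mul_sumKernel
    (hint : ∀ i j, Integrable (fun x => ψ i x * χ j x) μ) (x y : X) :
    Integrable (fun z => sumKernel ψ χ x z * sumKernel ψ χ z y) μ := by
  simp_rw [sumKernel_mul_sumKernel]
  exact integrable_finsetSum _ fun i _ => integrable_finsetSum _ fun j _ =>
    (hint j i).const_mul _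

theorem integral_sumKernel_mul_sumKernel
    (hint : ∀ i j, Integrable (fun x => ψ i x * χ j x) μ)
    (horth : ∀ i j, ∫ x, ψ i x * χ j x ∂μ = if i = j then 1 else 0) (x y : X) :
    ∫ z, sumKernel ψ χ x z * sumKernel ψ χ z y ∂μ = sumKernel ψ χ x y := by
  simp_rw [sumKernel_mul_sumKernel]
  rw [integral_finsetSum _ fun i _ => integrable_finsetSum _ fun j _ => (hint j i).const_mul _]
  refine Finset.sum_congr rfl fun i _ => ?_
  rw [integral_finsetSum _ fun j _ => (hint j i).const_mul _]
  simp_rw [integral_const_mul, horth]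
  simp

/-- In the bordered expansion the diagonal term integrates to N·det. By the reproducing property the
remaining double sum becomes the trace of K·adj K, that is, the number of points times det. -/
theorem integral_kernelDet_sum_unit (hint : ∀ i j, Integrable (fun x => ψ i x * χ j x) μ)
    (horth : ∀ i j, ∫ x, ψ i x * χ j x ∂μ = if i = j then 1 else 0)
    {ι : Type*} [Fintype ι] [DecidableEq ι] (y : ι → X) :
    ∫ z, kernelDet ψ χ (Sum.elim y fun _ : Unit => z) ∂μ =
      ((N : ℝ) - Fintype.card ι) * kernelDet ψ χ y := by
  simp_rw [kernelDet_sum_unit]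
  have h2 : ∀ i j, Integrable (fun z =>
      (Matrix.of fun a b => sumKernel ψ χ (y a) (y b)).adjugate j i *
        (sumKernel ψ χ (y i) z * sumKernel ψ χ z (y j))) μ := fun i j =>
    (integrable_sumKernel_mul_sumKernel hint _ _).const_mul _
  rw [integral_sub ((integrable_sumKernel_self hint).mul_const _)
    (integrable_finsetSum _ fun i _ => integrable_finsetSum _ fun j _ => h2 i j),
    integral_mul_const, integral_sumKernel_self hint horth,
    integral_finsetSum _ fun i _ => integrable_finsetSum _ fun j _ => h2 i j]
  simp_rw [integral_finsetSum _ fun j _ => h2 _ j, integral_const_mul,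
    integral_sumKernel_mul_sumKernel hint horth]
  rw [sub_mul]
  congr 1
  have h := congrArg Matrix.trace
    (Matrix.mul_adjugate (Matrix.of fun a b => sumKernel ψ χ (y a) (y b)))
  simp only [Matrix.trace, Matrix.diag_apply, Matrix.mul_apply, Matrix.smul_apply, Matrix.of_apply,
    Matrix.one_apply_eq, smul_eq_mul, mul_one, Finset.sum_const, Finset.card_univ,
    nsmul_eq_mul] at h
  rw [kernelDet, ← h]
  exact Finset.sum_congr rfl fun i _ => Finset.sum_congr rfl fun j _ => mul_comm _ _

theorem integrable_kernelDet [SigmaFinite μ]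
    (hint : ∀ i j, Integrable (fun x => ψ i x * χ j x) μ)
    {ι : Type*} [Fintype ι] [DecidableEq ι] (m : ℕ) (y : ι → X) :
    Integrable (fun z : Fin m → X => kernelDet ψ χ (Sum.elim y z)) (Measure.pi fun _ => μ) := by
  simp_rw [kernelDet_eq_sum, Fintype.prod_sum_type, Sum.elim_inl, Sum.elim_inr]
  refine integrable_finsetSum _ fun σ _ => integrable_finsetSum _ fun f _ =>
    Integrable.const_mul (Integrable.const_mul ?_ _) _
  exact Integrable.fintype_prod
    (f := fun a x => ψ (f (σ.symm (Sum.inr a))) x * χ (f (Sum.inr a)) x) fun a => hint _ _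

theorem integral_kernelDet [SigmaFinite μ]
    (hint : ∀ i j, Integrable (fun x => ψ i x * χ j x) μ)
    (horth : ∀ i j, ∫ x, ψ i x * χ j x ∂μ = if i = j then 1 else 0) (m : ℕ) :
    ∀ {ι : Type} [Fintype ι] [DecidableEq ι] (y : ι → X),
      ∫ z : Fin m → X, kernelDet ψ χ (Sum.elim y z) ∂(Measure.pi fun _ => μ) =
        (∏ j ∈ Finset.range m, ((N : ℝ) - Fintype.card ι - j)) * kernelDet ψ χ y := by
  induction m with
  | zero =>
    intro ι _ _ y
    rw [Measure.pi_of_empty, integral_dirac, Finset.range_zero, Finset.prod_empty, one_mul,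
      ← kernelDet_comp_equiv ψ χ (Equiv.sumEmpty ι (Fin 0)) y]
    congr 1
    ext (a | a)
    · rfl
    · exact a.elim0
  | succ m ih =>
    intro ι _ _ y
    have hmp := measurePreserving_piFinSuccAbove (fun _ : Fin (m + 1) => μ) 0
    rw [← hmp.symm.integral_comp', integral_prod]
    -- The first integration variable joins the fixed points. The induction hypothesis over the
    -- index type ι ⊕ Unit removes the other variables, and the one-point lemma then removes this
    -- one, giving the factor j = 0.
    · let e : (ι ⊕ Unit) ⊕ Fin m ≃ ι ⊕ Fin (m + 1) :=
        (Equiv.sumAssoc ι Unit (Fin m)).trans (Equiv.sumCongr (Equiv.refl ι)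
          ((Equiv.sumComm _ _).trans
            ((Equiv.optionEquivSumPUnit _).symm.trans (finSuccEquiv m).symm)))
      have he : ∀ (z0 : X) (z : Fin m → X),
          kernelDet ψ χ (Sum.elim y
            ((MeasurableEquiv.piFinSuccAbove (fun _ : Fin (m + 1) => X) 0).symm (z0, z))) =
          kernelDet ψ χ (Sum.elim (Sum.elim y fun _ : Unit => z0) z) := by
        intro z0 z
        rw [← kernelDet_comp_equiv ψ χ e]
        congr 1
        ext ((a | a) | a)
        · rfl
        · simp [e, MeasurableEquiv.piFinSuccAbove]
        · simp [e, MeasurableEquiv.piFinSuccAbove]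
      simp_rw [he, ih]
      rw [integral_const_mul, integral_kernelDet_sum_unit hint horth, ← mul_assoc,
        Finset.prod_range_succ']
      congr 2
      · refine Finset.prod_congr rfl fun j _ => ?_
        simp
        ring
      · simp
    · exact ((hmp.symm _).integrable_comp_emb (MeasurableEquiv.measurableEmbedding _)).2
        (integrable_kernelDet hint (m + 1) y)

end Determinantal

/-- Integrating out N - k points yields (N-k)(N-k-1)⋯1 = (N-k)!, which cancels the combinatorial
prefactor together with the 1/N! in `hP`. Only positive points matter, since the integration runs
over the open orthant. -/
theorem correlationFunction_eq_kernelDet {N : ℕ} {ψ χ : Fin N → ℝ → ℝ}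
    (hint : ∀ i j, IntegrableOn (fun x => ψ i x * χ j x) (Ioi 0))
    (horth : ∀ i j, ∫ x in Ioi (0 : ℝ), ψ i x * χ j x = if i = j then 1 else 0)
    {P : (Fin N → ℝ) → ℝ}
    (hP : ∀ y, (∀ i, 0 < y i) → P y = (N ! : ℝ)⁻¹ * kernelDet ψ χ y)
    (k : ℕ) (hk : k ≤ N) (y : Fin k → ℝ) (hy : ∀ i, 0 < y i) :
    IntegrableOn (densitySection P k hk y) (Set.univ.pi fun _ : Fin (N - k) => Ioi (0 : ℝ)) ∧
      correlationFunction P k hk y = kernelDet ψ χ y := by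
  have hms : MeasurableSet (Set.univ.pi fun _ : Fin (N - k) => Ioi (0 : ℝ)) :=
    MeasurableSet.univ_pi fun _ => measurableSet_Ioi
  have hsec : EqOn (fun z => (N ! : ℝ)⁻¹ * kernelDet ψ χ (Sum.elim y z)) (densitySection P k hk y)
      (Set.univ.pi fun _ : Fin (N - k) => Ioi (0 : ℝ)) := by
    intro z hz
    have hz' : ∀ i, 0 < z i := fun i => hz i (mem_univ i)
    unfold densitySection
    rw [hP]
    · simp only
      rw [← kernelDet_comp_equiv ψ χ (finSumFinEquiv.trans (finCongr (Nat.add_sub_of_le hk)))]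
      congr 2
      ext (a | a)
      · simp
      · simp
    · intro i
      generalize Fin.cast (Nat.add_sub_of_le hk).symm i = j
      induction j using Fin.addCases with
      | left j => simpa using hy j
      | right j => simpa using hz' j
  have hμ : (volume : Measure (Fin (N - k) → ℝ)).restrict
      (Set.univ.pi fun _ : Fin (N - k) => Ioi (0 : ℝ)) =
      Measure.pi fun _ => (volume : Measure ℝ).restrict (Ioi 0) := by
    rw [volume_pi, Measure.restrict_pi_pi]
  have hI := (integrable_kernelDet hint (N - k) y).const_mul (N ! : ℝ)⁻¹
  rw [← hμ] at hI
  refine ⟨IntegrableOn.congr_fun hI hsec hms, ?_⟩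
  unfold correlationFunction
  rw [← setIntegral_congr_fun hms hsec, hμ, integral_const_mul,
    integral_kernelDet hint horth (N - k) y]
  have hprod : ∏ j ∈ Finset.range (N - k), ((N : ℝ) - Fintype.card (Fin k) - j) = (N - k)! := by
    rw [← Finset.prod_range_add_one_eq_factorial, ← Finset.prod_range_reflect]
    push_cast
    refine Finset.prod_congr rfl fun j hj => ?_
    have := Finset.mem_range.1 hj
    rw [Fintype.card_fin, Nat.sub_sub, Nat.cast_sub (by lia), Nat.cast_sub hk]
    push_cast
    ring
  rw [hprod]
  have h1 : (N ! : ℝ) ≠ 0 := by positivity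
  have h2 : ((N - k)! : ℝ) ≠ 0 := by positivity
  field_simp

/-! ### Lagrange interpolation at distinct nodes -/

section Interpolation

variable {F : Type*} [Field F] {n : ℕ} {x : Fin n → F}

/-- The sum is the coefficient of X^(n-1) in the interpolation polynomial, which is `p` itself. -/
theorem sum_eval_div_prod_erase_eq_zero (hx : Function.Injective x) {p : Polynomial F}
    (hp : p.natDegree + 1 < n) :
    ∑ i, p.eval (x i) / ∏ l ∈ Finset.univ.erase i, (x i - x l) = 0 := by
  have h := Lagrange.coeff_eq_sum (s := Finset.univ) (v := x) hx.injOn (P := p)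
    (lt_of_le_of_lt Polynomial.degree_le_natDegree (by
      rw [Finset.card_univ, Fintype.card_fin]; exact_mod_cast (by lia : p.natDegree < n)))
  rw [← h, Polynomial.coeff_eq_zero_of_natDegree_lt]
  simp
  lia

theorem eval_eq_sum_prod_erase (hx : Function.Injective x) {p : Polynomial F}
    (hp : p.natDegree < n) (t : F) :
    p.eval t = ∑ i, p.eval (x i) * ∏ l ∈ Finset.univ.erase i, (t - x l) / (x i - x l) := by
  have h := Lagrange.eq_interpolate (s := Finset.univ) (v := x) hx.injOn (f := p)
    (lt_of_le_of_lt Polynomial.degree_le_natDegree (by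
      rw [Finset.card_univ, Fintype.card_fin]; exact_mod_cast hp))
  conv_lhs => rw [h]
  rw [Lagrange.interpolate_apply, Polynomial.eval_finsetSum]
  refine Finset.sum_congr rfl fun i _ => ?_
  rw [Polynomial.eval_mul, Polynomial.eval_C, Lagrange.basis, Polynomial.eval_prod]
  congr 1
  refine Finset.prod_congr rfl fun l _ => ?_
  simp [Lagrange.basisDivisor]
  ring

end Interpolation

/-! ### The Cauchy–Vandermonde matrix -/

section CauchyVandermonde

theorem natDegree_prod_X_sub_C {ι : Type*} (s : Finset ι) (d : ι → ℝ) :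
    (∏ l ∈ s, (Polynomial.X - Polynomial.C (d l))).natDegree = s.card :=
  Polynomial.natDegree_finsetProd_X_sub_C_eq_card s d

/-- The coefficients that, paired with the Cauchy–Vandermonde matrix, give its inverse on the
Cauchy columns. -/
noncomputable def biorthCoeff {M N : ℕ} (x : Fin M → ℝ) (d : Fin N → ℝ) (j : Fin N) (i : Fin M) : ℝ :=
  (∏ l, (x i - d l)) / (∏ l ∈ Finset.univ.erase i, (x i - x l)) *
    ((∏ l ∈ Finset.univ.erase i, (d j - x l)) / ∏ l ∈ Finset.univ.erase j, (d j - d l))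

variable {M N : ℕ} {x : Fin M → ℝ} {d : Fin N → ℝ}

/-- Moving the factor x_i - d_j from one product to the other leaves, as a function of i, a
polynomial of degree N - 1 over the nodal product: the form to which interpolation identities apply.
-/
theorem biorthCoeff_eq (j : Fin N) (i : Fin M) :
    biorthCoeff x d j i =
      -((∏ l, (d j - x l)) / ∏ l ∈ Finset.univ.erase j, (d j - d l)) *
        ((∏ l ∈ Finset.univ.erase j, (x i - d l)) / ∏ l ∈ Finset.univ.erase i, (x i - x l)) := by
  unfold biorthCoeff
  rw [← Finset.mul_prod_erase Finset.univ _ (Finset.mem_univ j),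
    ← Finset.mul_prod_erase Finset.univ (fun l => d j - x l) (Finset.mem_univ i)]
  ring

theorem sum_biorthCoeff_mul_pow (hx : Function.Injective x) (j : Fin N) {k : ℕ} (hk : k + N < M) : ∑ i, biorthCoeff x d j i * x i ^ k = 0 := by
  have hN : 0 < N := j.pos
  have h := sum_eval_div_prod_erase_eq_zero hx
    (p := Polynomial.X ^ k * ∏ l ∈ Finset.univ.erase j, (Polynomial.X - Polynomial.C (d l))) (by
      refine lt_of_le_of_lt (Nat.add_le_add_right Polynomial.natDegree_mul_le 1) ?_
      rw [natDegree_prod_X_sub_C, Polynomial.natDegree_X_pow, Finset.card_erase_of_mem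
        (Finset.mem_univ j), Finset.card_univ, Fintype.card_fin]
      lia)
  simp only [Polynomial.eval_mul, Polynomial.eval_pow, Polynomial.eval_X, Polynomial.eval_prod,
    Polynomial.eval_sub, Polynomial.eval_C] at h
  simp_rw [biorthCoeff_eq, mul_assoc]
  rw [← Finset.mul_sum]
  convert mul_zero _
  rw [← h]
  exact Finset.sum_congr rfl fun i _ => by ring

/-- For j = m this is interpolation of ∏_{l≠j} (X - d_l) evaluated at d_j. For j ≠ m the factor x_i
- d_m cancels, and the remaining polynomial has degree N - 2, too small for a nonzero top
coefficient. -/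
theorem sum_biorthCoeff_mul_inv_sub (hx : Function.Injective x) (hd : Function.Injective d)
    (hxd : ∀ i j, x i ≠ d j) (hNM : N ≤ M) (j m : Fin N) :
    ∑ i, biorthCoeff x d j i * (x i - d m)⁻¹ = if j = m then 1 else 0 := by
  have hN : 0 < N := j.pos
  have hne : ∀ i j, x i - d j ≠ 0 := fun i j => sub_ne_zero.2 (hxd i j)
  split_ifs with hjm
  · subst hjm
    have h := eval_eq_sum_prod_erase hx
      (p := ∏ l ∈ Finset.univ.erase j, (Polynomial.X - Polynomial.C (d l))) (by
        rw [natDegree_prod_X_sub_C, Finset.card_erase_of_mem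
          (Finset.mem_univ j), Finset.card_univ, Fintype.card_fin]
        lia) (d j)
    simp only [Polynomial.eval_X, Polynomial.eval_prod,
      Polynomial.eval_sub, Polynomial.eval_C] at h
    have hD : ∏ l ∈ Finset.univ.erase j, (d j - d l) ≠ 0 := Finset.prod_ne_zero_iff.2
      fun l hl => sub_ne_zero.2 (hd.ne (Finset.ne_of_mem_erase hl).symm)
    rw [← div_self hD, eq_div_iff hD]
    conv_rhs => rw [h]
    rw [Finset.sum_mul]
    refine Finset.sum_congr rfl fun i _ => ?_
    unfold biorthCoeff
    rw [← Finset.mul_prod_erase Finset.univ _ (Finset.mem_univ j), Finset.prod_div_distrib]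
    have := hne i j
    field_simp
  · have h := sum_eval_div_prod_erase_eq_zero hx
      (p := ∏ l ∈ (Finset.univ.erase j).erase m, (Polynomial.X - Polynomial.C (d l))) (by
        rw [natDegree_prod_X_sub_C, Finset.card_erase_of_mem
          (Finset.mem_erase.2 ⟨Ne.symm hjm, Finset.mem_univ m⟩), Finset.card_erase_of_mem
          (Finset.mem_univ j), Finset.card_univ, Fintype.card_fin]
        have h1 := j.2
        have h2 := m.2
        have h3 : (j : ℕ) ≠ m := fun h => hjm (Fin.ext h)
        lia)
    simp only [Polynomial.eval_X, Polynomial.eval_prod,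
      Polynomial.eval_sub, Polynomial.eval_C] at h
    simp_rw [biorthCoeff_eq, mul_assoc]
    rw [← Finset.mul_sum]
    convert mul_zero _
    rw [← h]
    refine Finset.sum_congr rfl fun i _ => ?_
    rw [← Finset.mul_prod_erase (Finset.univ.erase j) (fun l => x i - d l)
      (Finset.mem_erase.2 ⟨Ne.symm hjm, Finset.mem_univ m⟩)]
    have := hne i m
    field_simp

theorem prod_prod_Ioi_const {N : ℕ} (a : ℝ) :
    ∏ j : Fin N, ∏ _k ∈ Finset.Ioi j, a = a ^ (N * (N - 1) / 2) := by
  simp_rw [Finset.prod_const, Fin.card_Ioi]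
  rw [Finset.prod_pow_eq_pow_sum, Fin.sum_univ_eq_sum_range (fun j => N - 1 - j) N,
    Finset.sum_range_reflect (fun j => j) N, Finset.sum_range_id]

theorem prod_prod_erase_sub (d : Fin N → ℝ) :
    ∏ j, ∏ l ∈ Finset.univ.erase j, (d j - d l) =
      (-1) ^ (N * (N - 1) / 2) * vandermondeProd d ^ 2 := by
  have h1 : ∀ j : Fin N, ∏ l ∈ Finset.univ.erase j, (d j - d l) =
      (∏ l ∈ Finset.Ioi j, (d j - d l)) * ∏ l ∈ Finset.Iio j, (d j - d l) := by
    intro j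
    rw [← Finset.prod_union]
    · congr 1
      ext l
      simp only [Finset.mem_erase, Finset.mem_univ, and_true, Finset.mem_union, Finset.mem_Ioi,
        Finset.mem_Iio]
      exact ne_comm.trans lt_or_lt_iff_ne.symm
    · rw [Finset.disjoint_left]
      intro l hl hl'
      exact lt_asymm (Finset.mem_Ioi.1 hl) (Finset.mem_Iio.1 hl')
  simp_rw [h1, Finset.prod_mul_distrib]
  have h2 : ∏ j : Fin N, ∏ l ∈ Finset.Iio j, (d j - d l) = vandermondeProd d := by
    unfold vandermondeProd
    exact Finset.prod_comm' fun i j => by simp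
  have h3 : ∏ j : Fin N, ∏ l ∈ Finset.Ioi j, (d j - d l) =
      (-1) ^ (N * (N - 1) / 2) * vandermondeProd d := by
    unfold vandermondeProd
    rw [← prod_prod_Ioi_const, ← Finset.prod_mul_distrib]
    refine Finset.prod_congr rfl fun j _ => ?_
    rw [← Finset.prod_mul_distrib]
    exact Finset.prod_congr rfl fun l _ => by ring
  rw [h2, h3]
  ring

theorem vandermondeProd_ne_zero (hd : Function.Injective d) : vandermondeProd d ≠ 0 :=
  Finset.prod_ne_zero_iff.2 fun _ _ => Finset.prod_ne_zero_iff.2 fun _ hk =>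
    sub_ne_zero.2 (hd.ne (Finset.mem_Ioi.1 hk).ne')

theorem vandermondeProd_mul (a : ℝ) (d : Fin N → ℝ) :
    vandermondeProd (fun j => a * d j) = a ^ (N * (N - 1) / 2) * vandermondeProd d := by
  unfold vandermondeProd
  rw [← prod_prod_Ioi_const, ← Finset.prod_mul_distrib]
  refine Finset.prod_congr rfl fun j _ => ?_
  rw [← Finset.prod_mul_distrib]
  exact Finset.prod_congr rfl fun l _ => by ring

/-- The block swap is the n-th power of the cyclic rotation, and n(n-1) is even. -/
theorem sign_finAddFlip (m n : ℕ) :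
    Equiv.Perm.sign ((finAddFlip (m := m) (n := n)).trans (finCongr (Nat.add_comm n m))) =
      (-1) ^ (n * m) := by
  have h : (finAddFlip (m := m) (n := n)).trans (finCongr (Nat.add_comm n m)) =
      finRotate (m + n) ^ n := by
    have hpow : ∀ k, ∀ i : Fin (m + n), (((finRotate (m + n)) ^ k) i : ℕ) = (i + k) % (m + n) := by
      intro k i
      induction k with
      | zero => simp [Nat.mod_eq_of_lt i.2]
      | succ k ih =>
        obtain ⟨p, hp⟩ : ∃ p, m + n = p + 1 := Nat.exists_eq_succ_of_ne_zero (by have := i.2; lia)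
        have hval : ∀ j : Fin (m + n), (finRotate (m + n) j : ℕ) = (j + 1) % (m + n) := by
          rw [hp]
          intro j
          rw [finRotate_apply, Fin.val_add]
          simp
        rw [pow_succ', Equiv.Perm.mul_apply, hval, ih]
        rw [Nat.mod_add_mod, add_assoc]
    ext i
    rw [hpow]
    induction i using Fin.addCases with
    | left i =>
      simp [finAddFlip_apply_castAdd]
      rw [Nat.mod_eq_of_lt (by have := i.2; lia), add_comm]
    | right i =>
      simp [finAddFlip_apply_natAdd]
      rw [Nat.mod_eq_sub_mod (by lia), Nat.mod_eq_of_lt (by have := i.2; lia)]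
      lia
  rw [h, map_pow, sign_finRotate, ← pow_mul]
  rcases Nat.eq_zero_or_pos n with rfl | hn
  · simp
  · have h : (m + n - 1) * n = n * m + n * (n - 1) := by
      rw [Nat.add_sub_assoc hn]; ring
    rw [h, pow_add, (Nat.even_mul_pred_self n).neg_one_pow, mul_one]

/-- The matrix with columns `1, x_i, …, x_i^{ν-1}` followed by the columns of `G`. -/
def powAppend (ν : ℕ) (x : Fin (ν + N) → ℝ) (G : Matrix (Fin (ν + N)) (Fin N) ℝ) :
    Matrix (Fin (ν + N)) (Fin (ν + N)) ℝ :=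
  Matrix.of fun i c => Fin.append (fun k : Fin ν => x i ^ (k : ℕ)) (G i) c

/-- Clearing denominators row by row turns all columns into values of polynomials: X^k ∏ (X - d_l),
and ∏_{l≠j} (X - d_l). A change of basis `T` replaces the latter by 1, X, …, X^{N-1}. The result is,
up to a block swap of columns, a family of monic polynomials of degrees 0, …, ν+N-1, with
Vandermonde determinant. -/
theorem det_powAppend_cauchy_monic {ν : ℕ} {x : Fin (ν + N) → ℝ}
    (hd : Function.Injective d) (hxd : ∀ i j, x i ≠ d j) :
    (powAppend ν x (Matrix.of fun i j => (x i - d j)⁻¹)).det =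
      (-1) ^ (N * ν + N * (N - 1) / 2) * (vandermondeProd x * vandermondeProd d) /
        ∏ i, ∏ j, (x i - d j) := by
  have hne : ∀ i j, x i - d j ≠ 0 := fun i j => sub_ne_zero.2 (hxd i j)
  have hP : ∏ i, ∏ j, (x i - d j) ≠ 0 :=
    Finset.prod_ne_zero_iff.2 fun i _ => Finset.prod_ne_zero_iff.2 fun j _ => hne i j
  rw [eq_div_iff hP, mul_comm, ← Matrix.det_mul_column]
  set W : Matrix (Fin (ν + N)) (Fin (ν + N)) ℝ := Matrix.of fun i j => (∏ j, (x i - d j)) *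
    powAppend ν x (Matrix.of fun i j => (x i - d j)⁻¹) i j with hW
  -- Column m of `T` holds the coordinates of X^m in the basis ∏_{l≠j} (X - d_l), by Lagrange
  -- interpolation at the nodes d_j.
  set T : Matrix (Fin N) (Fin N) ℝ := Matrix.of fun j m =>
    (∏ l ∈ Finset.univ.erase j, (d j - d l))⁻¹ * Matrix.vandermonde d j m with hT
  have hdetT : T.det * ∏ j, ∏ l ∈ Finset.univ.erase j, (d j - d l) = vandermondeProd d := by
    rw [hT, Matrix.det_mul_column, Matrix.det_vandermonde, Finset.prod_inv_distrib]
    rw [mul_comm, ← mul_assoc, mul_inv_cancel₀, one_mul]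
    · rfl
    · rw [prod_prod_erase_sub]
      exact mul_ne_zero (pow_ne_zero _ (by norm_num)) (pow_ne_zero _ (vandermondeProd_ne_zero hd))
  let p : Fin (ν + N) → Polynomial ℝ := fun c =>
    if (c : ℕ) < N then Polynomial.X ^ (c : ℕ) else
      Polynomial.X ^ ((c : ℕ) - N) * ∏ l, (Polynomial.X - Polynomial.C (d l))
  have hmonic : (∏ l, (Polynomial.X - Polynomial.C (d l))).Monic :=
    Polynomial.monic_prod_of_monic _ _ fun l _ => Polynomial.monic_X_sub_C _
  have hdetU := Matrix.det_eval_matrixOfPolynomials_eq_det_vandermonde x p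
    (fun c => by
      simp only [p]
      split_ifs with h
      · simp
      · rw [(Polynomial.monic_X_pow _).natDegree_mul hmonic, natDegree_prod_X_sub_C]
        simp
        lia)
    (fun c => by
      simp only [p]
      split_ifs with h
      · exact Polynomial.monic_X_pow _
      · exact (Polynomial.monic_X_pow _).mul hmonic)
  set τ := (finAddFlip (m := ν) (n := N)).trans (finCongr (Nat.add_comm N ν)) with hτ
  have hperm := Matrix.det_permute' τ (Matrix.of fun i j => Polynomial.eval (x i) (p j))
  have hmul : W * (Matrix.fromBlocks 1 0 0 T).submatrix finSumFinEquiv.symm finSumFinEquiv.symm =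
      (Matrix.of fun i j => Polynomial.eval (x i) (p j)).submatrix id τ := by
    ext i c
    rw [Matrix.mul_apply, ← finSumFinEquiv.sum_comp, Fintype.sum_sum_type]
    simp only [Matrix.submatrix_apply, Equiv.symm_apply_apply, id, Matrix.of_apply]
    induction c using Fin.addCases with
    | left k =>
      have hk : ((τ (Fin.castAdd N k)) : ℕ) = k + N := by
        simp [hτ, finAddFlip_apply_castAdd, add_comm]
      simp only [p, hk, finSumFinEquiv_symm_apply_castAdd, Matrix.fromBlocks_apply₁₁,
        Matrix.fromBlocks_apply₂₁, Matrix.zero_apply, mul_zero, Finset.sum_const_zero, add_zero,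
        Matrix.one_apply, mul_ite, mul_one, Finset.sum_ite_eq', Finset.mem_univ, if_true,
        finSumFinEquiv_apply_left]
      simp [hW, powAppend, Polynomial.eval_prod, mul_comm]
    | right m =>
      have hm : ((τ (Fin.natAdd ν m)) : ℕ) = m := by
        simp [hτ, finAddFlip_apply_natAdd]
      simp only [p, hm, finSumFinEquiv_symm_apply_natAdd, Matrix.fromBlocks_apply₁₂,
        Matrix.fromBlocks_apply₂₂, Matrix.zero_apply, mul_zero, Finset.sum_const_zero, zero_add,
        m.2, if_true, finSumFinEquiv_apply_right]
      rw [eval_eq_sum_prod_erase hd (by simp) (x i)]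
      refine Finset.sum_congr rfl fun j _ => ?_
      simp only [hW, hT, powAppend, Matrix.of_apply, Fin.append_right, Matrix.vandermonde_apply,
        Polynomial.eval_pow, Polynomial.eval_X]
      rw [← Finset.mul_prod_erase Finset.univ _ (Finset.mem_univ j), Finset.prod_div_distrib]
      have := hne i j
      field_simp
  have hdet := congrArg Matrix.det hmul
  rw [Matrix.det_mul, Matrix.det_submatrix_equiv_self, Matrix.det_fromBlocks_zero₂₁,
    Matrix.det_one, one_mul, hperm, hτ, sign_finAddFlip, ← hdetU, Matrix.det_vandermonde] at hdet
  have hVd := vandermondeProd_ne_zero hd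
  rw [prod_prod_erase_sub] at hdetT
  refine mul_right_cancel₀ hVd ?_
  conv_lhs => rw [← hdetT]
  calc W.det * (T.det * ((-1) ^ (N * (N - 1) / 2) * vandermondeProd d ^ 2)) =
        (W.det * T.det) * ((-1) ^ (N * (N - 1) / 2) * vandermondeProd d ^ 2) := by ring
    _ = _ := by
        rw [hdet, pow_add]
        push_cast
        simp only [vandermondeProd]
        ring

theorem det_powAppend_cauchy {ν : ℕ} {α : ℝ} (hα : 0 < α) {q : Fin (ν + N) → ℝ}
    (hd : Function.Injective d) (hqd : ∀ i j, α * q i ≠ d j) :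
    (powAppend ν q (Matrix.of fun i j => (α * q i - d j)⁻¹)).det =
      (-α) ^ (N * ν + N * (N - 1) / 2) * (vandermondeProd q * vandermondeProd d) /
        ∏ i, ∏ j, (α * q i - d j) := by
  have hα' := hα.ne'
  have hsub : ∀ i j, α * q i - d j = α * (q i - α⁻¹ * d j) := fun i j => by field_simp
  -- The factor α is taken out of the Cauchy columns only, so that the monomial columns remain
  -- powers of q rather than of α q.
  have hmat : powAppend ν q (Matrix.of fun i j => (α * q i - d j)⁻¹) =
      Matrix.of fun i c => (Fin.append (fun _ : Fin ν => (1 : ℝ)) (fun _ : Fin N => α⁻¹) c) *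
        powAppend ν q (Matrix.of fun i j => (q i - α⁻¹ * d j)⁻¹) i c := by
    ext i c
    induction c using Fin.addCases with
    | left k => simp [powAppend]
    | right j => simp [powAppend, hsub, mul_comm]
  rw [hmat, Matrix.det_mul_row, Fin.prod_univ_add,
    det_powAppend_cauchy_monic (d := fun j => α⁻¹ * d j)
      (fun a b h => hd (mul_left_cancel₀ (inv_ne_zero hα') h))
      (fun i j h => hqd i j (by rw [h]; field_simp)), vandermondeProd_mul]
  simp only [Fin.append_left, Fin.append_right, Finset.prod_const_one, one_mul, hsub,
    Finset.prod_const, Finset.prod_mul_distrib, Finset.card_univ, Fintype.card_fin]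
  rw [neg_eq_neg_one_mul α, mul_pow (-1 : ℝ) α]
  rw [mul_div_assoc, mul_div_assoc]
  have hpow : (α ^ N) ^ (ν + N) = α ^ (N * ν + N * (N - 1) / 2) * α ^ N * α ^ (N * (N - 1) / 2) := by
    rw [← pow_mul, ← pow_add, ← pow_add]
    congr 1
    have h1 : N * (N - 1) / 2 * 2 = N * (N - 1) := Nat.div_mul_cancel
      (Nat.even_mul_pred_self N).two_dvd
    have h2 : N * (N - 1) + N = N * N := by
      cases N with
      | zero => rfl
      | succ n => simp; ring
    rw [mul_add]
    lia
  rw [hpow]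
  by_cases hP : ∏ i, ∏ j, (q i - α⁻¹ * d j) = 0
  · simp [hP]
  · generalize ∏ i, ∏ j, (q i - α⁻¹ * d j) = Q at hP ⊢
    simp only [inv_pow]
    field_simp

/-- Stack `C` below the first ν rows `R` of the inverse of the matrix built from `G`. Multiplying by
the matrix built from any A gives a block triangular matrix with diagonal blocks 1 and C·A;
comparing A = Φ with A = G eliminates the determinant of the stack. -/
theorem det_powAppend_eq_mul_det {ν : ℕ} {q : Fin (ν + N) → ℝ}
    {G Φ : Matrix (Fin (ν + N)) (Fin N) ℝ} {C : Matrix (Fin N) (Fin (ν + N)) ℝ}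
    (hV : ∀ (j : Fin N) (k : Fin ν), ∑ i, C j i * q i ^ (k : ℕ) = 0) (hG : C * G = 1)
    (hdet : (powAppend ν q G).det ≠ 0) :
    (powAppend ν q Φ).det = (powAppend ν q G).det * (C * Φ).det := by
  set V : Matrix (Fin (ν + N)) (Fin ν) ℝ := Matrix.of fun i k => q i ^ (k : ℕ) with hVdef
  have hpa : ∀ A : Matrix (Fin (ν + N)) (Fin N) ℝ, powAppend ν q A =
      (Matrix.fromCols V A).submatrix id finSumFinEquiv.symm := by
    intro A
    ext i c
    induction c using Fin.addCases with
    | left k => simp [powAppend, hVdef]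
    | right j => simp [powAppend]
  set R : Matrix (Fin ν) (Fin (ν + N)) ℝ :=
    (powAppend ν q G)⁻¹.submatrix (fun k => Fin.castAdd N k) id with hR
  have hRV : R * V = 1 := by
    have h := Matrix.nonsing_inv_mul (powAppend ν q G) (isUnit_iff_ne_zero.2 hdet)
    ext k l
    have h1 := congrFun (congrFun h (Fin.castAdd N k)) (Fin.castAdd N l)
    rw [Matrix.mul_apply] at h1 ⊢
    simpa [hR, hVdef, powAppend, Matrix.one_apply] using h1
  have hCV : C * V = 0 := by
    ext j k
    rw [Matrix.mul_apply]
    exact hV j k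
  set S : Matrix (Fin (ν + N)) (Fin (ν + N)) ℝ :=
    (Matrix.fromRows R C).submatrix finSumFinEquiv.symm id with hS
  have hmul : ∀ A : Matrix (Fin (ν + N)) (Fin N) ℝ,
      S.det * (powAppend ν q A).det = (C * A).det := by
    intro A
    rw [← Matrix.det_mul, hS, hpa, ← Matrix.submatrix_mul _ _ _ id _ Function.bijective_id,
      Matrix.fromRows_mul_fromCols, Matrix.det_submatrix_equiv_self, hRV, hCV,
      Matrix.det_fromBlocks_zero₂₁, Matrix.det_one, one_mul]
  have h1 := hmul G
  rw [hG, Matrix.det_one] at h1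
  rw [← hmul Φ, ← mul_assoc, mul_comm _ S.det, h1, one_mul]

end CauchyVandermonde

/-! ### Contour integrals -/

section Contour

theorem isCompact_contourImage {γ : ℝ → ℂ} (hγ : IsClosedContour γ) :
    IsCompact (contourImage γ) := isCompact_Icc.image_of_continuousOn hγ.continuousOn

theorem isPreconnected_contourImage {γ : ℝ → ℂ} (hγ : IsClosedContour γ) :
    IsPreconnected (contourImage γ) := isPreconnected_Icc.image _ hγ.continuousOn

theorem mem_contourImage {γ : ℝ → ℂ} {t : ℝ} (ht : t ∈ Icc (0 : ℝ) 1) : γ t ∈ contourImage γ :=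
  mem_image_of_mem γ ht

theorem IsClosedContour.exists_deriv_bound {γ : ℝ → ℂ} (hγ : IsClosedContour γ) :
    ∃ C : ℝ, ∀ᵐ t ∂(volume.restrict (Icc (0 : ℝ) 1)), ‖deriv γ t‖ ≤ C := by
  obtain ⟨S, C, h⟩ := hγ.piecewise
  refine ⟨C, ?_⟩
  have hS : ∀ᵐ t : ℝ, t ∉ (S : Set ℝ) ∪ {0, 1} := by
    refine (Set.Finite.countable ?_).ae_notMem volume
    exact S.finite_toSet.union (by simp)
  filter_upwards [ae_restrict_mem measurableSet_Icc, ae_restrict_of_ae hS] with t ht htS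
  simp only [mem_union, Finset.mem_coe, mem_insert_iff, mem_singleton_iff, not_or] at htS
  exact (h t ⟨lt_of_le_of_ne ht.1 (Ne.symm htS.2.1), lt_of_le_of_ne ht.2 htS.2.2⟩ htS.1).2.2

theorem continuousOn_comp_contour {γ : ℝ → ℂ} (hγ : IsClosedContour γ) {f : ℂ → ℂ}
    (hf : ContinuousOn f (contourImage γ)) : ContinuousOn (fun t => f (γ t)) (Icc 0 1) :=
  hf.comp hγ.continuousOn fun _ ht => mem_contourImage ht

theorem integrableOn_contour {γ : ℝ → ℂ} (hγ : IsClosedContour γ) {f : ℂ → ℂ}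
    (hf : ContinuousOn f (contourImage γ)) :
    IntegrableOn (fun t => f (γ t) * deriv γ t) (Icc 0 1) := by
  obtain ⟨C, hC⟩ := hγ.exists_deriv_bound
  have hc := continuousOn_comp_contour hγ hf
  have hd : IntegrableOn (deriv γ) (Icc 0 1) :=
    Measure.integrableOn_of_bounded (by simp) (stronglyMeasurable_deriv γ).aestronglyMeasurable hC
  exact hd.continuousOn_mul hc isCompact_Icc

theorem intervalIntegrable_contour {γ : ℝ → ℂ} (hγ : IsClosedContour γ) {f : ℂ → ℂ}
    (hf : ContinuousOn f (contourImage γ)) :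
    IntervalIntegrable (fun t => f (γ t) * deriv γ t) volume 0 1 :=
  (intervalIntegrable_iff_integrableOn_Icc_of_le zero_le_one).2 (integrableOn_contour hγ hf)

theorem contourIntegral_add {γ : ℝ → ℂ} (hγ : IsClosedContour γ) {f g : ℂ → ℂ}
    (hf : ContinuousOn f (contourImage γ)) (hg : ContinuousOn g (contourImage γ)) :
    contourIntegral (fun z => f z + g z) γ = contourIntegral f γ + contourIntegral g γ := by
  unfold contourIntegral
  rw [← intervalIntegral.integral_add (intervalIntegrable_contour hγ hf)
    (intervalIntegrable_contour hγ hg)]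
  simp_rw [add_mul]

theorem contourIntegral_const_mul {γ : ℝ → ℂ} (c : ℂ) (f : ℂ → ℂ) :
    contourIntegral (fun z => c * f z) γ = c * contourIntegral f γ := by
  unfold contourIntegral
  rw [← intervalIntegral.integral_const_mul]
  simp_rw [mul_assoc]

theorem contourIntegral_sum {γ : ℝ → ℂ} (hγ : IsClosedContour γ) {ι : Type*} (s : Finset ι)
    {f : ι → ℂ → ℂ} (hf : ∀ i ∈ s, ContinuousOn (f i) (contourImage γ)) :
    contourIntegral (fun z => ∑ i ∈ s, f i z) γ = ∑ i ∈ s, contourIntegral (f i) γ := by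
  unfold contourIntegral
  rw [← intervalIntegral.integral_finsetSum fun i hi => intervalIntegrable_contour hγ (hf i hi)]
  simp_rw [Finset.sum_mul]

theorem contourIntegral_congr {γ : ℝ → ℂ} {f g : ℂ → ℂ} (h : EqOn f g (contourImage γ)) :
    contourIntegral f γ = contourIntegral g γ := by
  refine intervalIntegral.integral_congr fun t ht => ?_
  rw [uIcc_of_le zero_le_one] at ht
  simp only [h (mem_contourImage ht)]

/-- Where the derivative is nonzero the curve leaves `a` at once, so such parameters form a
discrete, hence countable, set. Thus the value of an integrand at one point never affects a contour
integral, even if the contour rests there. -/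
theorem ae_deriv_eq_zero_of_eq (γ : ℝ → ℂ) (a : ℂ) :
    ∀ᵐ t : ℝ, γ t = a → deriv γ t = 0 := by
  set T : Set ℝ := {t | γ t = a ∧ deriv γ t ≠ 0}
  have hT : T.Countable := by
    have hdisc : DiscreteTopology T := by
      rw [discreteTopology_subtype_iff]
      intro t ht
      have hd := (differentiableAt_of_deriv_ne_zero ht.2).hasDerivAt
      have hne := hd.eventually_ne ht.2 (c := a)
      rw [Filter.inf_principal_eq_bot]
      filter_upwards [hne] with s hs hsT using hs hsT.1
    exact countable_of_Lindelof_of_discrete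
  filter_upwards [hT.ae_notMem volume] with t ht h
  by_contra hd
  exact ht ⟨h, hd⟩

theorem contourIntegral_congr_of_ne {γ : ℝ → ℂ} {f g : ℂ → ℂ} (a : ℂ)
    (h : ∀ z ∈ contourImage γ, z ≠ a → f z = g z) :
    contourIntegral f γ = contourIntegral g γ := by
  refine intervalIntegral.integral_congr_ae ?_
  filter_upwards [ae_deriv_eq_zero_of_eq γ a] with t ht htI
  rw [uIoc_of_le zero_le_one] at htI
  by_cases hta : γ t = a
  · simp [ht hta]
  · rw [h _ (mem_contourImage (Ioc_subset_Icc_self htI)) hta]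

theorem contourIntegral_eq_zero_of_hasDerivAt {γ : ℝ → ℂ} (hγ : IsClosedContour γ) {f F : ℂ → ℂ}
    (hF : ∀ z ∈ contourImage γ, HasDerivAt F (f z) z) (hf : ContinuousOn f (contourImage γ)) :
    contourIntegral f γ = 0 := by
  obtain ⟨S, C, h⟩ := hγ.piecewise
  have hFc : ContinuousOn F (contourImage γ) := fun z hz => (hF z hz).continuousAt.continuousWithinAt
  unfold contourIntegral
  rw [integral_eq_of_hasDerivAt_off_countable (fun t => F (γ t)) (fun t => f (γ t) * deriv γ t)
    S.countable_toSet]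
  · rw [hγ.closed, sub_self]
  · rw [uIcc_of_le zero_le_one]
    exact continuousOn_comp_contour hγ hFc
  · intro t ht
    rw [min_eq_left zero_le_one, max_eq_right zero_le_one] at ht
    have h1 := (h t ht.1 ht.2).1.hasDerivAt
    have h2 := HasDerivAt.scomp t (hF (γ t) (mem_contourImage (Ioo_subset_Icc_self ht.1))) h1
    rw [mul_comm]
    exact h2
  · exact intervalIntegrable_contour hγ hf

theorem contourIntegral_eq_zero_of_isExactOn {γ : ℝ → ℂ} (hγ : IsClosedContour γ) {U : Set ℂ}
    (hγU : contourImage γ ⊆ U) {f : ℂ → ℂ} (hf : DifferentiableOn ℂ f U)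
    (hU : Complex.IsExactOn f U) : contourIntegral f γ = 0 := by
  obtain ⟨F, hF⟩ := hU
  exact contourIntegral_eq_zero_of_hasDerivAt hγ (fun z hz => hF z (hγU hz))
    (hf.continuousOn.mono hγU)

/-- Holomorphic functions on the slit plane have primitives: pull back to the strip
`|Im w| < π` under the exponential function. -/
theorem isExactOn_slitPlane {f : ℂ → ℂ} (hf : DifferentiableOn ℂ f Complex.slitPlane) :
    Complex.IsExactOn f Complex.slitPlane := by
  set S : Set ℂ := {w | w.im ∈ Ioo (-Real.pi) Real.pi} with hS
  have hSo : IsOpen S := isOpen_Ioo.preimage Complex.continuous_im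
  have hSc : Convex ℝ S := (convex_Ioo _ _).is_linear_preimage Complex.imLm.isLinear
  have hmaps : MapsTo Complex.exp S Complex.slitPlane := by
    intro w hw
    rw [Complex.mem_slitPlane_iff_arg, ← Complex.log_im, Complex.log_exp hw.1 hw.2.le]
    exact ⟨hw.2.ne, Complex.exp_ne_zero w⟩
  have hg : DifferentiableOn ℂ (fun w => f (Complex.exp w) * Complex.exp w) S :=
    (hf.comp Complex.differentiable_exp.differentiableOn hmaps).mul
      Complex.differentiable_exp.differentiableOn
  obtain ⟨G, hG⟩ := hSc.exists_forall_hasDerivWithinAt hg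
  refine ⟨fun z => G (Complex.log z), fun z hz => ?_⟩
  have hz0 := Complex.slitPlane_ne_zero hz
  have hlog : Complex.log z ∈ S := by
    simp only [hS, mem_ofPred_eq, Complex.log_im]
    exact ⟨Complex.neg_pi_lt_arg z, lt_of_le_of_ne (Complex.arg_le_pi z)
      (Complex.mem_slitPlane_iff_arg.1 hz).1⟩
  have h1 := ((hG _ hlog).hasDerivAt (hSo.mem_nhds hlog)).comp z (Complex.hasDerivAt_log hz)
  rw [Complex.exp_log hz0, mul_inv_cancel_right₀ hz0] at h1
  exact h1

theorem isExactOn_univ {f : ℂ → ℂ} (hf : DifferentiableOn ℂ f univ) :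
    Complex.IsExactOn f univ := (differentiableOn_univ.1 hf).isExactOn_univ

variable {γ : ℝ → ℂ} {U : Set ℂ}

/-- Split f(z)/(z - a) into the difference quotient, holomorphic after removing the singularity and
hence exact, and f(a)/(z - a). The hypothesis on `U` stands for simple connectedness; it is used for
the slit plane and for the whole plane. -/
theorem contourIntegral_div_sub (hγ : IsClosedContour γ) (hUo : IsOpen U)
    (hU : ∀ f : ℂ → ℂ, DifferentiableOn ℂ f U → Complex.IsExactOn f U)
    (hγU : contourImage γ ⊆ U) {f : ℂ → ℂ} (hf : DifferentiableOn ℂ f U) {a : ℂ} (ha : a ∈ U)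
    (haγ : a ∉ contourImage γ) :
    contourIntegral (fun z => f z / (z - a)) γ = f a * (2 * Real.pi * Complex.I *
      windingNumber γ a) := by
  have hds : DifferentiableOn ℂ (dslope f a) U :=
    (Complex.differentiableOn_dslope (hUo.mem_nhds ha)).2 hf
  have hne : ∀ z ∈ contourImage γ, z - a ≠ 0 := fun z hz =>
    sub_ne_zero.2 (ne_of_mem_of_not_mem hz haγ)
  have h0 := contourIntegral_eq_zero_of_isExactOn hγ hγU hds (hU _ hds)
  have hw : contourIntegral (fun z => (z - a)⁻¹) γ =
      2 * Real.pi * Complex.I * windingNumber γ a := by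
    unfold windingNumber
    have := Complex.two_pi_I_ne_zero
    field_simp
  rw [← hw, ← contourIntegral_const_mul, ← zero_add (contourIntegral (fun z => f a * _) γ), ← h0,
    ← contourIntegral_add hγ (hds.continuousOn.mono hγU)]
  · refine contourIntegral_congr fun z hz => ?_
    have hz' := hne z hz
    simp only [dslope_of_ne _ (sub_ne_zero.1 hz'), slope_def_field]
    field_simp
    ring
  · exact continuousOn_const.mul ((continuousOn_id.sub continuousOn_const).inv₀ hne)

theorem contourIntegral_div_sub_of_notMem (hγ : IsClosedContour γ)
    (hU : ∀ f : ℂ → ℂ, DifferentiableOn ℂ f U → Complex.IsExactOn f U)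
    (hγU : contourImage γ ⊆ U) {f : ℂ → ℂ} (hf : DifferentiableOn ℂ f U) {a : ℂ} (ha : a ∉ U) :
    contourIntegral (fun z => f z / (z - a)) γ = 0 := by
  have hd : DifferentiableOn ℂ (fun z => f z / (z - a)) U :=
    hf.div (differentiableOn_id.sub (differentiableOn_const a)) fun z hz =>
      sub_ne_zero.2 (ne_of_mem_of_not_mem hz ha)
  exact contourIntegral_eq_zero_of_isExactOn hγ hγU hd (hU _ hd)

theorem windingNumber_eq_zero_of_notMem (hγ : IsClosedContour γ)
    (hU : ∀ f : ℂ → ℂ, DifferentiableOn ℂ f U → Complex.IsExactOn f U)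
    (hγU : contourImage γ ⊆ U) {a : ℂ} (ha : a ∉ U) : windingNumber γ a = 0 := by
  have h := contourIntegral_div_sub_of_notMem hγ hU hγU (differentiableOn_const (c := (1 : ℂ))) ha
  simp only [one_div] at h
  rw [windingNumber, h, zero_div]

/-- For b near a, the quotient (z - b)/(z - a) stays within distance 1 of 1 on the contour, so its
principal logarithm is a primitive of the difference of the two integrands. Integrality of winding
numbers is not needed. -/
theorem windingNumber_eventually_eq (hγ : IsClosedContour γ) {a : ℂ} (ha : a ∉ contourImage γ) :
    ∀ᶠ b in 𝓝 a, windingNumber γ b = windingNumber γ a := by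
  obtain ⟨r, hr, hball⟩ := Metric.isOpen_iff.1 (isCompact_contourImage hγ).isClosed.isOpen_compl a ha
  filter_upwards [Metric.ball_mem_nhds a hr] with b hb
  have hnb : ∀ z ∈ contourImage γ, z - b ≠ 0 := fun z hz h =>
    hball hb (by rwa [← sub_eq_zero.1 h])
  have hna : ∀ z ∈ contourImage γ, z - a ≠ 0 := fun z hz h =>
    ha (by rwa [← sub_eq_zero.1 h])
  have hslit : ∀ z ∈ contourImage γ, (z - b) / (z - a) ∈ Complex.slitPlane := by
    intro z hz
    have h1 : (z - b) / (z - a) = 1 + (a - b) / (z - a) := by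
      have := hna z hz
      field_simp
      ring
    rw [h1]
    refine Complex.mem_slitPlane_of_norm_lt_one ?_
    rw [norm_div, div_lt_one (norm_pos_iff.2 (hna z hz))]
    have h2 : r ≤ ‖z - a‖ := by
      by_contra hlt
      exact hball (by simpa [dist_eq_norm] using hlt) hz
    refine lt_of_lt_of_le ?_ h2
    rw [← dist_eq_norm, dist_comm]
    exact hb
  have hcb : ContinuousOn (fun z => (z - b)⁻¹) (contourImage γ) :=
    (continuousOn_id.sub continuousOn_const).inv₀ hnb
  have hca : ContinuousOn (fun z => (-1 : ℂ) * (z - a)⁻¹) (contourImage γ) :=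
    continuousOn_const.mul ((continuousOn_id.sub continuousOn_const).inv₀ hna)
  have h0 : contourIntegral (fun z => (z - b)⁻¹ + -1 * (z - a)⁻¹) γ = 0 := by
    refine contourIntegral_eq_zero_of_hasDerivAt hγ
      (F := fun z => Complex.log ((z - b) / (z - a))) (fun z hz => ?_) (hcb.add hca)
    have hb' := hnb z hz
    have ha' := hna z hz
    have h1 : HasDerivAt (fun z => (z - b) / (z - a)) ((1 * (z - a) - (z - b) * 1) / (z - a) ^ 2) z :=
      ((hasDerivAt_id z).sub_const b).div ((hasDerivAt_id z).sub_const a) ha'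
    convert h1.clog (hslit z hz) using 1
    field_simp
    ring
  rw [contourIntegral_add hγ hcb hca, contourIntegral_const_mul] at h0
  unfold windingNumber
  rw [show contourIntegral (fun z => (z - b)⁻¹) γ = contourIntegral (fun z => (z - a)⁻¹) γ by
    linear_combination h0]

theorem windingNumber_eq_of_isPreconnected (hγ : IsClosedContour γ) {S : Set ℂ}
    (hS : IsPreconnected S) (hd : Disjoint S (contourImage γ)) {a b : ℂ} (ha : a ∈ S)
    (hb : b ∈ S) : windingNumber γ a = windingNumber γ b := by
  have hopen : ∀ p : ℂ → Prop, IsOpen {z | z ∉ contourImage γ ∧ p (windingNumber γ z)} := by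
    intro p
    rw [isOpen_iff_mem_nhds]
    intro z hz
    filter_upwards [windingNumber_eventually_eq hγ hz.1,
      (isCompact_contourImage hγ).isClosed.isOpen_compl.mem_nhds hz.1] with w hw hw'
    exact ⟨hw', by rw [hw]; exact hz.2⟩
  have hsub := hS.subset_left_of_subset_union (hopen (· = windingNumber γ a))
    (hopen (· ≠ windingNumber γ a))
    (Set.disjoint_left.2 fun z hz hz' => hz'.2 hz.2)
    (fun z hz => by
      have := Set.disjoint_left.1 hd hz
      by_cases h : windingNumber γ z = windingNumber γ a
      · exact Or.inl ⟨this, h⟩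
      · exact Or.inr ⟨this, h⟩)
    ⟨a, ha, Set.disjoint_left.1 hd ha, rfl⟩
  exact (hsub hb).2.symm

theorem integrableOn_contour_prod {γ₁ γ₂ : ℝ → ℂ} (h₁ : IsClosedContour γ₁)
    (h₂ : IsClosedContour γ₂) {G : ℂ → ℂ → ℂ}
    (hG : ContinuousOn (fun p : ℂ × ℂ => G p.1 p.2) (contourImage γ₁ ×ˢ contourImage γ₂)) :
    IntegrableOn (fun p : ℝ × ℝ => G (γ₁ p.1) (γ₂ p.2) * deriv γ₁ p.1 * deriv γ₂ p.2)
      (Icc 0 1 ×ˢ Icc 0 1) := by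
  have hd : ∀ {γ : ℝ → ℂ}, IsClosedContour γ → IntegrableOn (deriv γ) (Icc 0 1) := fun h => by
    simpa using integrableOn_contour h (f := fun _ => 1) continuousOn_const
  have hI : IntegrableOn (fun p : ℝ × ℝ => deriv γ₁ p.1 * deriv γ₂ p.2) (Icc 0 1 ×ˢ Icc 0 1) := by
    rw [IntegrableOn, Measure.volume_eq_prod, ← Measure.prod_restrict]
    exact Integrable.mul_prod (hd h₁) (hd h₂)
  have hc : ContinuousOn (fun p : ℝ × ℝ => G (γ₁ p.1) (γ₂ p.2)) (Icc 0 1 ×ˢ Icc 0 1) := by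
    refine hG.comp (f := fun p : ℝ × ℝ => (γ₁ p.1, γ₂ p.2)) (ContinuousOn.prodMk ?_ ?_) ?_
    · exact h₁.continuousOn.comp continuousOn_fst fun p hp => hp.1
    · exact h₂.continuousOn.comp continuousOn_snd fun p hp => hp.2
    · exact fun p hp => ⟨mem_contourImage hp.1, mem_contourImage hp.2⟩
  have := hI.continuousOn_mul hc (isCompact_Icc.prod isCompact_Icc)
  simpa only [mul_assoc] using this

/-! ### Partial fractions -/

/-- With Q = ∏ (X - x_l), the quotient (Q - Q(ζ))/(X - ζ) has degree M - 1 and takes the value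
Q(ζ)/(ζ - x_i) at x_i; the identity is its Lagrange interpolation evaluated at η. -/
theorem sum_lagrange_mul_inv_sub {M : ℕ} (hM : 0 < M) {x : Fin M → ℂ} (hx : Function.Injective x)
    {η ζ : ℂ} (hζ : ∀ i, ζ ≠ x i) (hηζ : η ≠ ζ) :
    ∑ i, (∏ l ∈ Finset.univ.erase i, (η - x l) / (x i - x l)) * (ζ - x i)⁻¹ =
      (∏ l, (η - x l) / (ζ - x l) - 1) / (η - ζ) := by
  set Q : Polynomial ℂ := ∏ l, (Polynomial.X - Polynomial.C (x l)) with hQ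
  have hQeval : ∀ z, Q.eval z = ∏ l, (z - x l) := by
    intro z
    simp [hQ, Polynomial.eval_prod]
  set p := (Q - Polynomial.C (Q.eval ζ)) /ₘ (Polynomial.X - Polynomial.C ζ) with hp
  have hmul : (Polynomial.X - Polynomial.C ζ) * p = Q - Polynomial.C (Q.eval ζ) :=
    Polynomial.mul_divByMonic_eq_iff_isRoot.2 (by simp)
  have hdeg : p.natDegree < M := by
    rw [hp, Polynomial.natDegree_divByMonic _ (Polynomial.monic_X_sub_C ζ),
      Polynomial.natDegree_sub_C, hQ, Polynomial.natDegree_finsetProd_X_sub_C_eq_card]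
    simp [hM]
  have heval : ∀ z, (z - ζ) * p.eval z = Q.eval z - Q.eval ζ := by
    intro z
    simpa using congrArg (Polynomial.eval z) hmul
  have hQζ : Q.eval ζ ≠ 0 := by
    rw [hQeval]
    exact Finset.prod_ne_zero_iff.2 fun i _ => sub_ne_zero.2 (hζ i)
  have hpx : ∀ i, p.eval (x i) = Q.eval ζ * (ζ - x i)⁻¹ := by
    intro i
    have h1 := heval (x i)
    have h2 : Q.eval (x i) = 0 := by
      rw [hQeval]
      exact Finset.prod_eq_zero (Finset.mem_univ i) (sub_self _)
    have h3 : ζ - x i ≠ 0 := sub_ne_zero.2 (hζ i)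
    rw [h2] at h1
    field_simp
    linear_combination -h1
  have h := eval_eq_sum_prod_erase hx hdeg η
  simp_rw [hpx] at h
  have hne : η - ζ ≠ 0 := sub_ne_zero.2 hηζ
  rw [Finset.prod_div_distrib, ← hQeval, ← hQeval, eq_div_iff hne]
  have h4 := heval η
  rw [h, Finset.mul_sum] at h4
  rw [Finset.sum_mul]
  have h5 : Q.eval η / Q.eval ζ - 1 = (Q.eval η - Q.eval ζ) / Q.eval ζ := by field_simp
  rw [h5, ← h4, Finset.sum_div]
  refine Finset.sum_congr rfl fun i _ => ?_
  field_simp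

theorem inv_prod_sub_eq_sum {N : ℕ} (hN : 0 < N) {d : Fin N → ℂ} (hd : Function.Injective d)
    {η : ℂ} (hη : ∀ j, η ≠ d j) :
    (∏ l, (η - d l))⁻¹ = ∑ j, (∏ l ∈ Finset.univ.erase j, (d j - d l))⁻¹ * (η - d j)⁻¹ := by
  -- The partial fractions come from interpolating the constant 1, which needs at least one node.
  have h := eval_eq_sum_prod_erase hd (p := 1) (by simpa using hN) η
  have hne : ∀ j, η - d j ≠ 0 := fun j => sub_ne_zero.2 (hη j)
  have hP : ∏ l, (η - d l) ≠ 0 := Finset.prod_ne_zero_iff.2 fun j _ => hne j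
  simp only [Polynomial.eval_one, one_mul] at h
  rw [inv_eq_one_div, div_eq_iff hP, h, Finset.sum_mul]
  refine Finset.sum_congr rfl fun j _ => ?_
  rw [Finset.prod_div_distrib, ← Finset.mul_prod_erase Finset.univ _ (Finset.mem_univ j)]
  have := hne j
  field_simp

/-! ### The double contour integral as a finite sum -/

/-- In ζ the integrand splits into simple poles at the x_i and at η. The pole at η cancels the
denominators η - d_l, leaving -w(η) A(η) B(η) with w the winding number of γq, which contributes
nothing; the poles at x_i leave only simple poles at the d_j in η. -/
theorem contourIntegral_contourIntegral_eq_sum {M N : ℕ} (hN : 0 < N) (hM : 0 < M)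
    {γδ γq : ℝ → ℂ}
    (hγδ : IsClosedContour γδ) (hγq : IsClosedContour γq)
    {x : Fin M → ℂ} (hx : Function.Injective x) {d : Fin N → ℂ} (hd : Function.Injective d)
    (hxslit : ∀ i, x i ∈ Complex.slitPlane)
    (hγδ_enc : ∀ j, Encircles γδ (d j)) (hγq_enc : ∀ i, Encircles γq (x i))
    (hγq_slit : contourImage γq ⊆ Complex.slitPlane)
    (hdisj : Disjoint (contourImage γδ) (contourImage γq))
    {A B : ℂ → ℂ} (hA : Differentiable ℂ A) (hB : DifferentiableOn ℂ B Complex.slitPlane) :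
    contourIntegral (fun η => contourIntegral (fun ζ => A η * B ζ / (η - ζ) *
        (∏ l, (ζ - d l) / (η - d l)) * ∏ l, (η - x l) / (ζ - x l)) γq
          / (2 * Real.pi * Complex.I)) γδ / (2 * Real.pi * Complex.I) =
      ∑ i, ∑ j, A (d j) * B (x i) *
        ((∏ l, (x i - d l)) / (∏ l ∈ Finset.univ.erase i, (x i - x l)) *
          ((∏ l ∈ Finset.univ.erase i, (d j - x l)) / ∏ l ∈ Finset.univ.erase j, (d j - d l))) := by
  have hpi := Complex.two_pi_I_ne_zero
  set c : ℂ := 2 * Real.pi * Complex.I with hc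
  set F : ℂ → ℂ := fun ζ => B ζ * ∏ l, (ζ - d l) with hFdef
  have hF : DifferentiableOn ℂ F Complex.slitPlane := hB.mul (by fun_prop)
  set L : Fin M → ℂ → ℂ := fun i η => ∏ l ∈ Finset.univ.erase i, (η - x l) / (x i - x l) with hL
  have hLd : ∀ i, Differentiable ℂ (L i) := fun i => by
    simp only [hL, div_eq_mul_inv]
    fun_prop
  have hexact : ∀ f : ℂ → ℂ, DifferentiableOn ℂ f Complex.slitPlane →
      Complex.IsExactOn f Complex.slitPlane := fun f hf => isExactOn_slitPlane hf
  have hexact' : ∀ f : ℂ → ℂ, DifferentiableOn ℂ f univ →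
      Complex.IsExactOn f univ := fun f hf => isExactOn_univ hf
  have hηd : ∀ η ∈ contourImage γδ, ∀ j, η - d j ≠ 0 := fun η hη j =>
    sub_ne_zero.2 (ne_of_mem_of_not_mem hη (hγδ_enc j).1)
  have hζx : ∀ ζ ∈ contourImage γq, ∀ i, ζ - x i ≠ 0 := fun ζ hζ i =>
    sub_ne_zero.2 (ne_of_mem_of_not_mem hζ (hγq_enc i).1)
  have hηζ : ∀ η ∈ contourImage γδ, ∀ ζ ∈ contourImage γq, η - ζ ≠ 0 := fun η hη ζ hζ =>
    sub_ne_zero.2 fun h => Set.disjoint_left.1 hdisj hη (h ▸ hζ)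
  -- the inner integral
  have hinner : ∀ η ∈ contourImage γδ,
      contourIntegral (fun ζ => A η * B ζ / (η - ζ) *
        (∏ l, (ζ - d l) / (η - d l)) * ∏ l, (η - x l) / (ζ - x l)) γq / c =
      (-windingNumber γq η) * (A η * B η) +
        ∑ i, F (x i) * (A η * L i η * (∏ l, (η - d l))⁻¹) := by
    intro η hη
    have hcont1 : ContinuousOn (fun ζ => -1 * (F ζ / (ζ - η))) (contourImage γq) :=
      continuousOn_const.mul ((hF.continuousOn.mono hγq_slit).div (by fun_prop)
        fun ζ hζ => by rw [← neg_sub]; exact neg_ne_zero.2 (hηζ η hη ζ hζ))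
    have hcont2 : ∀ i ∈ Finset.univ, ContinuousOn (fun ζ => L i η * (F ζ / (ζ - x i)))
        (contourImage γq) := fun i _ =>
      continuousOn_const.mul ((hF.continuousOn.mono hγq_slit).div (by fun_prop)
        fun ζ hζ => hζx ζ hζ i)
    have h1 : contourIntegral (fun ζ => A η * B ζ / (η - ζ) *
        (∏ l, (ζ - d l) / (η - d l)) * ∏ l, (η - x l) / (ζ - x l)) γq =
        (A η * (∏ l, (η - d l))⁻¹) * contourIntegral (fun ζ => -1 * (F ζ / (ζ - η)) +
          ∑ i, L i η * (F ζ / (ζ - x i))) γq := by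
      rw [← contourIntegral_const_mul]
      refine contourIntegral_congr fun ζ hζ => ?_
      have h2 := sum_lagrange_mul_inv_sub hM hx (fun i => sub_ne_zero.1 (hζx ζ hζ i))
        (sub_ne_zero.1 (hηζ η hη ζ hζ))
      have h3 : ∑ i, L i η * (F ζ / (ζ - x i)) =
          F ζ * ∑ i, (∏ l ∈ Finset.univ.erase i, (η - x l) / (x i - x l)) * (ζ - x i)⁻¹ := by
        rw [Finset.mul_sum]
        exact Finset.sum_congr rfl fun i _ => by simp only [hL]; ring
      have h4 : ζ - η = -(η - ζ) := by ring
      have h5 := hηζ η hη ζ hζ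
      rw [h3, h2, h4, Finset.prod_div_distrib (f := fun l => ζ - d l)]
      generalize ∏ l, (η - x l) / (ζ - x l) = Y
      simp only [hFdef]
      field_simp
      ring
    rw [h1, contourIntegral_add hγq hcont1 (continuousOn_finsetSum _ hcont2),
      contourIntegral_sum hγq _ hcont2]
    simp_rw [contourIntegral_const_mul]
    have h6 : ∀ i, contourIntegral (fun ζ => F ζ / (ζ - x i)) γq = F (x i) * c := by
      intro i
      rw [contourIntegral_div_sub hγq Complex.isOpen_slitPlane hexact hγq_slit hF (hxslit i)
        (hγq_enc i).1, (hγq_enc i).2, mul_one]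
    -- Off the slit plane `F` need not be holomorphic at η, but there the integral and the winding
    -- number both vanish.
    have h7 : contourIntegral (fun ζ => F ζ / (ζ - η)) γq = F η * (c * windingNumber γq η) := by
      by_cases hs : η ∈ Complex.slitPlane
      · exact contourIntegral_div_sub hγq Complex.isOpen_slitPlane hexact hγq_slit hF hs
          (Set.disjoint_left.1 hdisj hη)
      · rw [contourIntegral_div_sub_of_notMem hγq hexact hγq_slit hF hs,
          windingNumber_eq_zero_of_notMem hγq hexact hγq_slit hs]
        ring
    simp_rw [h6, h7]
    rw [div_eq_iff hpi, mul_add, add_mul, Finset.mul_sum, Finset.sum_mul]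
    congr 1
    · have hP : ∏ l, (η - d l) ≠ 0 := Finset.prod_ne_zero_iff.2 fun j _ => hηd η hη j
      simp only [hFdef]
      field_simp
    · exact Finset.sum_congr rfl fun i _ => by ring
  have hterm : ∀ i, ContinuousOn (fun η => F (x i) * (A η * L i η * (∏ l, (η - d l))⁻¹))
      (contourImage γδ) := fun i =>
    continuousOn_const.mul ((hA.continuous.mul (hLd i).continuous).continuousOn.mul
      (ContinuousOn.inv₀ (by fun_prop) fun η hη =>
        Finset.prod_ne_zero_iff.2 fun j _ => hηd η hη j))
  -- the contribution of the pole at `ζ = η`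
  have hpole : contourIntegral (fun η => (-windingNumber γq η) * (A η * B η)) γδ = 0 ∧
      ContinuousOn (fun η => (-windingNumber γq η) * (A η * B η)) (contourImage γδ) := by
    -- The winding number is constant along γδ, which is connected and avoids γq. Either γδ stays in
    -- the slit plane, where A·B is exact, or it leaves it, and then the constant is 0.
    set w := windingNumber γq (γδ 0) with hw
    have hconst : EqOn (fun η => (-windingNumber γq η) * (A η * B η))
        (fun η => (-w) * (A η * B η)) (contourImage γδ) := by
      intro η hη
      simp only
      rw [windingNumber_eq_of_isPreconnected hγq (isPreconnected_contourImage hγδ) hdisj hη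
        (mem_contourImage (t := 0) (by simp))]
    rw [contourIntegral_congr hconst, contourIntegral_const_mul, continuousOn_congr hconst]
    by_cases hsub : contourImage γδ ⊆ Complex.slitPlane
    · have hAB : DifferentiableOn ℂ (fun η => A η * B η) Complex.slitPlane :=
        hA.differentiableOn.mul hB
      rw [contourIntegral_eq_zero_of_isExactOn hγδ hsub hAB (hexact _ hAB), mul_zero]
      exact ⟨rfl, continuousOn_const.mul (hAB.continuousOn.mono hsub)⟩
    · obtain ⟨η, hη, hηs⟩ := not_subset.1 hsub
      have hw0 : w = 0 := by
        rw [hw, windingNumber_eq_of_isPreconnected hγq (isPreconnected_contourImage hγδ) hdisj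
          (mem_contourImage (t := 0) (by simp)) hη,
          windingNumber_eq_zero_of_notMem hγq hexact hγq_slit hηs]
      rw [hw0]
      simp [continuousOn_const]
  rw [contourIntegral_congr hinner, contourIntegral_add hγδ hpole.2
    (continuousOn_finsetSum _ fun i _ => hterm i), hpole.1, zero_add,
    contourIntegral_sum hγδ _ fun i _ => hterm i, Finset.sum_div]
  refine Finset.sum_congr rfl fun i _ => ?_
  rw [contourIntegral_const_mul]
  have hAL : DifferentiableOn ℂ (fun η => A η * L i η) univ :=
    (hA.mul (hLd i)).differentiableOn
  have h8 : contourIntegral (fun η => A η * L i η * (∏ l, (η - d l))⁻¹) γδ =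
      contourIntegral (fun η => ∑ j, (∏ l ∈ Finset.univ.erase j, (d j - d l))⁻¹ *
        (A η * L i η / (η - d j))) γδ := by
    refine contourIntegral_congr fun η hη => ?_
    rw [inv_prod_sub_eq_sum hN hd fun j => sub_ne_zero.1 (hηd η hη j), Finset.mul_sum]
    exact Finset.sum_congr rfl fun j _ => by ring
  have h9 : ∀ j ∈ Finset.univ, ContinuousOn (fun η =>
      (∏ l ∈ Finset.univ.erase j, (d j - d l))⁻¹ * (A η * L i η / (η - d j))) (contourImage γδ) :=
    fun j _ => continuousOn_const.mul
      ((hAL.continuousOn.mono (subset_univ _)).div (by fun_prop) fun η hη => hηd η hη j)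
  rw [h8, contourIntegral_sum hγδ _ h9, Finset.mul_sum, Finset.sum_div]
  refine Finset.sum_congr rfl fun j _ => ?_
  rw [contourIntegral_const_mul, contourIntegral_div_sub hγδ isOpen_univ hexact' (subset_univ _)
    hAL (mem_univ _) (hγδ_enc j).1, (hγδ_enc j).2]
  simp only [hL, hFdef, ← hc]
  rw [Finset.prod_div_distrib]
  field_simp

end Contour

/-! ### The entire function attached to `I_κ` -/

section BesselI

/-- The entire function `∑ z^m / (m! (m+κ)!)`, so that `I_κ(2w) = w^κ besselEntire κ (w^2)`. -/
noncomputable def besselEntire (κ : ℕ) (z : ℂ) : ℂ :=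
  ∑' m : ℕ, z ^ m / ((m ! : ℂ) * ((m + κ)! : ℂ))

/-- `besselEntire` on the real line. -/
noncomputable def besselEntireReal (κ : ℕ) (x : ℝ) : ℝ :=
  ∑' m : ℕ, x ^ m / ((m ! : ℝ) * ((m + κ)! : ℝ))

theorem besselI_two_mul (κ : ℕ) (w : ℂ) :
    besselI κ (2 * w) = w ^ κ * besselEntire κ (w ^ 2) := by
  unfold besselI besselEntire
  rw [← tsum_mul_left]
  refine tsum_congr fun m => ?_
  rw [mul_div_cancel_left₀ w two_ne_zero, pow_add, pow_mul]
  ring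

theorem ofReal_besselEntireReal (κ : ℕ) (x : ℝ) :
    ((besselEntireReal κ x : ℝ) : ℂ) = besselEntire κ x := by
  unfold besselEntireReal besselEntire
  rw [Complex.ofReal_tsum]
  push_cast
  rfl

theorem differentiable_besselEntire (κ : ℕ) : Differentiable ℂ (besselEntire κ) := by
  intro z
  have hU : IsOpen (Metric.ball (0 : ℂ) (‖z‖ + 1)) := Metric.isOpen_ball
  refine (Complex.differentiableOn_tsum_of_summable_norm (U := Metric.ball (0 : ℂ) (‖z‖ + 1))
    (Real.summable_pow_div_factorial (‖z‖ + 1)) (fun m => ?_) hU fun m w hw => ?_).differentiableAt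
    (hU.mem_nhds (by simp))
  · fun_prop
  · rw [mem_ball_zero_iff] at hw
    rw [norm_div, norm_pow, norm_mul, Complex.norm_natCast, Complex.norm_natCast]
    have h1 : (0 : ℝ) < m ! := by positivity
    have h2 : (1 : ℝ) ≤ (m + κ)! := by exact_mod_cast Nat.factorial_pos _
    gcongr
    exact le_mul_of_one_le_right h1.le h2

theorem continuous_besselEntireReal (κ : ℕ) : Continuous (besselEntireReal κ) := by
  have h : besselEntireReal κ = fun x : ℝ => (besselEntire κ x).re := by
    ext x
    rw [← ofReal_besselEntireReal, Complex.ofReal_re]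
  rw [h]
  exact Complex.continuous_re.comp
    ((differentiable_besselEntire κ).continuous.comp Complex.continuous_ofReal)

theorem summable_besselEntireReal (κ : ℕ) (x : ℝ) :
    Summable fun m : ℕ => x ^ m / ((m ! : ℝ) * ((m + κ)! : ℝ)) := by
  refine Summable.of_norm_bounded (Real.summable_pow_div_factorial ‖x‖) fun m => ?_
  rw [norm_div, norm_pow, norm_mul, Real.norm_natCast, Real.norm_natCast]
  have h1 : (0 : ℝ) < m ! := by positivity
  have h2 : (1 : ℝ) ≤ (m + κ)! := by exact_mod_cast Nat.factorial_pos _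
  gcongr
  exact le_mul_of_one_le_right h1.le h2

theorem besselIReal_two_mul (κ : ℕ) (w : ℝ) :
    besselIReal κ (2 * w) = w ^ κ * besselEntireReal κ (w ^ 2) := by
  unfold besselIReal
  push_cast
  rw [besselI_two_mul, ← Complex.ofReal_pow, ← Complex.ofReal_pow, ← ofReal_besselEntireReal,
    ← Complex.ofReal_mul, Complex.ofReal_re]

theorem Complex.mul_ofReal_cpow {z : ℂ} (hz : z ≠ 0) {y : ℝ} (hy : 0 < y) (a : ℂ) :
    (z * y) ^ a = z ^ a * (y : ℂ) ^ a := by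
  have hy' : (y : ℂ) ≠ 0 := Complex.ofReal_ne_zero.2 hy.ne'
  rw [Complex.cpow_def_of_ne_zero (mul_ne_zero hz hy'), Complex.cpow_def_of_ne_zero hz,
    Complex.cpow_def_of_ne_zero hy', ← Complex.exp_add, mul_comm z, Complex.log_ofReal_mul hy hz,
    Complex.ofReal_log hy.le]
  ring_nf

theorem Complex.cpow_half_pow (z : ℂ) (κ : ℕ) : (z ^ (1 / 2 : ℂ)) ^ κ = z ^ ((κ : ℂ) / 2) := by
  rw [← Complex.cpow_nat_mul, mul_one_div]

theorem Complex.cpow_half_sq (z : ℂ) : (z ^ (1 / 2 : ℂ)) ^ 2 = z := by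
  rw [Complex.cpow_half_pow]
  norm_num

/-- This isolates the power η^{κ/2} by which the kernel divides; the other factor is entire in η. -/
theorem besselI_two_mul_cpow (κ : ℕ) {η : ℂ} (hη : η ≠ 0) {y : ℝ} (hy : 0 < y) :
    besselI κ (2 * (η * y) ^ (1 / 2 : ℂ)) =
      η ^ ((κ : ℂ) / 2) * ((y : ℂ) ^ ((κ : ℂ) / 2) * besselEntire κ (η * y)) := by
  rw [besselI_two_mul, Complex.cpow_half_pow, Complex.cpow_half_sq, Complex.mul_ofReal_cpow hη hy]
  ring

end BesselI

/-! ### The modified Bessel function of the second kind -/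

section BesselK

theorem Real.cosh_mul_le_exp (κ : ℕ) {t : ℝ} (ht : 0 ≤ t) : Real.cosh (κ * t) ≤ Real.exp (κ * t) := by
  rw [Real.cosh_eq]
  have : Real.exp (-(κ * t)) ≤ Real.exp (κ * t) := Real.exp_le_exp.2 (by
    have : (0 : ℝ) ≤ κ * t := by positivity
    linarith)
  linarith

theorem exists_exp_cosh_bound (κ : ℕ) {c : ℝ} (hc : 0 < c) :
    ∃ C : ℝ, ∀ t ∈ Ioi (0 : ℝ),
      Real.exp (-c * Real.cosh t) * Real.cosh (κ * t) * Real.cosh t ≤ C * Real.exp (-t) := by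
  -- From x^{κ+2}/(κ+2)! ≤ e^x at x = (c/2) e^t ≤ c cosh t. The exponent κ + 2 beats the growth
  -- e^{(κ+1)t} of the two cosh factors by e^{-t}; the second of them comes from differentiating
  -- under the integral.
  refine ⟨(κ + 2)! * (2 / c) ^ (κ + 2), fun t (ht : 0 < t) => ?_⟩
  have h1 := Real.cosh_mul_le_exp κ ht.le
  have h2 : Real.cosh t ≤ Real.exp t := by simpa using Real.cosh_mul_le_exp 1 ht.le
  have h3 : c / 2 * Real.exp t ≤ c * Real.cosh t := by
    rw [Real.cosh_eq]
    have := Real.exp_pos (-t)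
    nlinarith
  have h4 : (c / 2 * Real.exp t) ^ (κ + 2) / (κ + 2)! ≤ Real.exp (c * Real.cosh t) :=
    (Real.pow_div_factorial_le_exp _ (by positivity) _).trans (Real.exp_le_exp.2 h3)
  have h5 : Real.exp (-c * Real.cosh t) ≤
      (κ + 2)! * (2 / c) ^ (κ + 2) * Real.exp (-((κ + 2) * t)) := by
    rw [neg_mul, Real.exp_neg, Real.exp_neg]
    have h6 : (0 : ℝ) < (c / 2 * Real.exp t) ^ (κ + 2) / (κ + 2)! := by positivity
    refine (inv_anti₀ h6 h4).trans (le_of_eq ?_)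
    have h8 : (c / 2) ^ (κ + 2) * (2 / c) ^ (κ + 2) = 1 := by
      rw [← mul_pow, div_mul_div_comm, mul_comm c, div_self (by positivity), one_pow]
    have h9 : (c / 2) ^ (κ + 2) ≠ 0 := by positivity
    rw [inv_div, mul_pow, eq_inv_of_mul_eq_one_right h8, ← Real.exp_nat_mul]
    push_cast
    field_simp
  have h7 : Real.cosh (κ * t) * Real.cosh t ≤ Real.exp (κ * t) * Real.exp t :=
    mul_le_mul h1 h2 (Real.cosh_pos t).le (Real.exp_pos _).le
  rw [mul_assoc]
  refine (mul_le_mul h5 h7 (by positivity) (by positivity)).trans (le_of_eq ?_)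
  rw [mul_assoc, ← Real.exp_add, ← Real.exp_add]
  ring_nf

theorem integrableOn_exp_cosh (κ : ℕ) {c : ℝ} (hc : 0 < c) :
    IntegrableOn (fun t => Real.exp (-c * Real.cosh t) * Real.cosh (κ * t) * Real.cosh t)
      (Ioi 0) := by
  obtain ⟨C, hC⟩ := exists_exp_cosh_bound κ hc
  have h1 : IntegrableOn (fun t => C * Real.exp (-t)) (Ioi 0) := by
    have h := exp_neg_integrableOn_Ioi 0 one_pos
    simp only [neg_one_mul] at h
    exact h.const_mul C
  refine Integrable.mono' h1 (by fun_prop) ?_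
  filter_upwards [ae_restrict_mem measurableSet_Ioi] with t ht
  rw [Real.norm_of_nonneg (by positivity)]
  exact hC t ht

theorem integrableOn_besselK_integrand (κ : ℕ) {c : ℝ} (hc : 0 < c) :
    IntegrableOn (fun t => Real.exp (-c * Real.cosh t) * Real.cosh (κ * t)) (Ioi 0) := by
  refine Integrable.mono' (integrableOn_exp_cosh κ hc) (by fun_prop) ?_
  filter_upwards with t
  rw [Real.norm_of_nonneg (by positivity)]
  exact le_mul_of_one_le_right (by positivity) (Real.one_le_cosh t)

theorem norm_besselK_integrand (κ : ℕ) (z : ℂ) (t : ℝ) :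
    ‖Complex.exp (-z * (Real.cosh t : ℂ)) * (Real.cosh (κ * t) : ℂ)‖ =
      Real.exp (-z.re * Real.cosh t) * Real.cosh (κ * t) := by
  rw [norm_mul, Complex.norm_exp, Complex.norm_real, Real.norm_of_nonneg (Real.cosh_pos _).le]
  congr 2
  rw [Complex.re_mul_ofReal, Complex.neg_re]

theorem differentiableAt_besselK (κ : ℕ) {z : ℂ} (hz : 0 < z.re) :
    DifferentiableAt ℂ (besselK κ) z := by
  have hc : 0 < z.re / 2 := half_pos hz
  -- On this half plane the derivative of the integrand is dominated by the integrand's bound at c =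
  -- Re z / 2.
  have hs : {w : ℂ | z.re / 2 < w.re} ∈ 𝓝 z :=
    (isOpen_lt continuous_const Complex.continuous_re).mem_nhds (half_lt_self hz)
  refine (hasDerivAt_integral_of_dominated_loc_of_deriv_le (μ := volume.restrict (Ioi (0 : ℝ)))
    (F := fun (z : ℂ) (t : ℝ) => Complex.exp (-z * (Real.cosh t : ℂ)) * (Real.cosh (κ * t) : ℂ))
    (F' := fun (z : ℂ) (t : ℝ) => Complex.exp (-z * (Real.cosh t : ℂ)) * (Real.cosh (κ * t) : ℂ) *
      (-(Real.cosh t : ℂ)))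
    hs (Eventually.of_forall fun w => ?_) ?_ ?_ ?_ (integrableOn_exp_cosh κ hc)
    ?_).2.differentiableAt
  · exact Continuous.aestronglyMeasurable (by fun_prop)
  · refine Integrable.mono' (integrableOn_besselK_integrand κ hz)
      (Continuous.aestronglyMeasurable (by fun_prop)) (Eventually.of_forall fun t => ?_)
    exact (norm_besselK_integrand κ z t).le
  · exact Continuous.aestronglyMeasurable (by fun_prop)
  · filter_upwards with t w hw
    rw [norm_mul, norm_besselK_integrand, norm_neg, Complex.norm_real,
      Real.norm_of_nonneg (Real.cosh_pos _).le]
    have h1 : -w.re * Real.cosh t ≤ -(z.re / 2) * Real.cosh t :=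
      mul_le_mul_of_nonneg_right (neg_le_neg (le_of_lt hw)) (Real.cosh_pos t).le
    have := Real.cosh_pos t
    have := Real.cosh_pos (κ * t)
    gcongr
  · filter_upwards with t w _
    have h1 : HasDerivAt (fun w : ℂ => -w * (Real.cosh t : ℂ)) (-1 * (Real.cosh t : ℂ)) w :=
      (hasDerivAt_id w).neg.mul_const _
    refine (h1.cexp.mul_const (Real.cosh (κ * t) : ℂ)).congr_deriv ?_
    ring

/-- The principal root halves the argument, which then lies strictly between -π/2 and π/2; so
`besselK` is evaluated only where its integral converges. -/
theorem Complex.cpow_half_re_pos {z : ℂ} (hz : z ∈ Complex.slitPlane) :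
    0 < (z ^ (1 / 2 : ℂ)).re := by
  have hz0 := Complex.slitPlane_ne_zero hz
  rw [Complex.cpow_def_of_ne_zero hz0, Complex.exp_re]
  refine mul_pos (Real.exp_pos _) (Real.cos_pos_of_mem_Ioo ?_)
  have h1 : (Complex.log z * (1 / 2)).im = z.arg / 2 := by
    rw [mul_one_div, Complex.div_ofNat_im, Complex.log_im]
  rw [h1]
  have h2 := Complex.neg_pi_lt_arg z
  have h3 := lt_of_le_of_ne (Complex.arg_le_pi z) (Complex.mem_slitPlane_iff_arg.1 hz).1
  constructor <;> linarith

theorem Complex.mul_ofReal_mem_slitPlane {z : ℂ} (hz : z ∈ Complex.slitPlane) {y : ℝ}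
    (hy : 0 < y) : z * y ∈ Complex.slitPlane := by
  rw [Complex.mem_slitPlane_iff] at hz ⊢
  rw [Complex.re_mul_ofReal, Complex.im_mul_ofReal]
  exact hz.imp (fun h => mul_pos h hy) fun h => mul_ne_zero h hy.ne'

theorem differentiableOn_cpow_mul_besselK (κ : ℕ) {y : ℝ} (hy : 0 < y) :
    DifferentiableOn ℂ (fun ζ : ℂ => ζ ^ ((κ : ℂ) / 2) * besselK κ (2 * (ζ * y) ^ (1 / 2 : ℂ)))
      Complex.slitPlane := by
  intro ζ hζ
  have h1 := Complex.mul_ofReal_mem_slitPlane hζ hy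
  have h2 : 0 < (2 * (ζ * y) ^ (1 / 2 : ℂ)).re := by
    have := Complex.cpow_half_re_pos h1
    simp only [Complex.mul_re, Complex.re_ofNat, Complex.im_ofNat, zero_mul, sub_zero]
    linarith
  have h3 : DifferentiableAt ℂ (fun ζ : ℂ => 2 * (ζ * y) ^ (1 / 2 : ℂ)) ζ :=
    DifferentiableAt.const_mul (DifferentiableAt.cpow_const (f := fun ζ : ℂ => ζ * y)
      (by fun_prop) h1) 2
  have h4 : DifferentiableAt ℂ (fun ζ : ℂ => ζ ^ ((κ : ℂ) / 2)) ζ :=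
    DifferentiableAt.cpow_const differentiableAt_id hζ
  exact (h4.mul (DifferentiableAt.comp ζ (differentiableAt_besselK κ h2) h3)).differentiableWithinAt

theorem ofReal_besselK (κ : ℕ) (x : ℝ) : besselK κ (x : ℂ) =
    ((∫ t in Ioi (0 : ℝ), Real.exp (-x * Real.cosh t) * Real.cosh (κ * t) : ℝ) : ℂ) := by
  unfold besselK
  rw [← integral_complex_ofReal]
  push_cast
  rfl

theorem besselKReal_eq (κ : ℕ) (x : ℝ) : besselKReal κ x =
    ∫ t in Ioi (0 : ℝ), Real.exp (-x * Real.cosh t) * Real.cosh (κ * t) := by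
  rw [besselKReal, ofReal_besselK, Complex.ofReal_re]

theorem ofReal_besselKReal (κ : ℕ) (x : ℝ) : ((besselKReal κ x : ℝ) : ℂ) = besselK κ x := by
  rw [besselKReal_eq, ofReal_besselK]

theorem besselKReal_nonneg (κ : ℕ) (x : ℝ) : 0 ≤ besselKReal κ x := by
  rw [besselKReal_eq]
  exact integral_nonneg fun t => by positivity

theorem continuousOn_besselKReal (κ : ℕ) : ContinuousOn (besselKReal κ) (Ioi 0) := by
  intro x (hx : 0 < x)
  have h1 : ContinuousAt (fun x : ℝ => (besselK κ x).re) x :=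
    Complex.continuous_re.continuousAt.comp
      ((differentiableAt_besselK κ (z := x) (by simpa)).continuousAt.comp
        Complex.continuous_ofReal.continuousAt)
  exact h1.continuousWithinAt

end BesselK

/-! ### Moments of `K_κ` and its pairing with `I_κ` -/

section BesselMoments

theorem lintegral_rpow_mul_exp_eq (m : ℕ) {r : ℝ} (hr : 0 < r) :
    ∫⁻ y in Ioi (0 : ℝ), ENNReal.ofReal (y ^ m * Real.exp (-(r * y))) =
      ENNReal.ofReal ((m ! : ℝ) / r ^ (m + 1)) := by
  have h := Real.integral_rpow_mul_exp_neg_mul_Ioi (a := m + 1) (by positivity) hr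
  have h' : ∫ y in Ioi (0 : ℝ), y ^ m * Real.exp (-(r * y)) = (m ! : ℝ) / r ^ (m + 1) := by
    rw [Real.Gamma_nat_eq_factorial] at h
    simp only [add_sub_cancel_right, Real.rpow_natCast] at h
    rw [h, ← Nat.cast_add_one, Real.rpow_natCast, one_div, inv_pow]
    field_simp
  rw [← h', ofReal_integral_eq_lintegral_ofReal]
  -- A nonintegrable function would have Bochner integral 0, whereas this value is positive.
  · refine Integrable.of_integral_ne_zero ?_
    rw [h']
    positivity
  · filter_upwards [ae_restrict_mem measurableSet_Ioi] with y (hy : 0 < y)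
    simp only [Pi.zero_apply]
    positivity

/-- Substitute s = a e^t on s > a and s = a e^{-t} on s ≤ a: the exponent becomes -2a cosh t, and
the weights e^{κt} and e^{-κt} add up to 2 cosh(κt). The quotient s^κ / s avoids a truncated
exponent at κ = 0. -/
theorem lintegral_besselK_representation (κ : ℕ) {a : ℝ} (ha : 0 < a) :
    ∫⁻ s in Ioi (0 : ℝ), ENNReal.ofReal (s ^ κ / s * Real.exp (-s - a ^ 2 / s)) =
      ENNReal.ofReal (2 * (a ^ κ * besselKReal κ (2 * a))) := by
  set g : ℝ → ENNReal := fun s => ENNReal.ofReal (s ^ κ / s * Real.exp (-s - a ^ 2 / s)) with hg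
  have himg1 : (fun t => a * Real.exp t) '' Ioi 0 = Ioi a := by
    ext s
    constructor
    · rintro ⟨t, ht, rfl⟩
      exact lt_mul_of_one_lt_right ha (Real.one_lt_exp_iff.2 ht)
    · intro (hs : a < s)
      refine ⟨Real.log (s / a), Real.log_pos ((one_lt_div ha).2 hs), ?_⟩
      simp only
      rw [Real.exp_log (div_pos (ha.trans hs) ha)]
      field_simp
  have himg2 : (fun t => a * Real.exp (-t)) '' Ici 0 = Ioc 0 a := by
    ext s
    constructor
    · rintro ⟨t, ht, rfl⟩
      exact ⟨by positivity, mul_le_of_le_one_right ha.le (Real.exp_le_one_iff.2 (neg_nonpos.2 ht))⟩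
    · rintro ⟨hs, hsa⟩
      refine ⟨Real.log (a / s), Real.log_nonneg ((one_le_div hs).2 hsa), ?_⟩
      simp only
      rw [Real.exp_neg, Real.exp_log (div_pos ha hs)]
      field_simp
  have hcv : ∀ u : ℝ, ENNReal.ofReal |a * Real.exp u| * g (a * Real.exp u) =
      ENNReal.ofReal (a ^ κ * (Real.exp (κ * u) * Real.exp (-(2 * a) * Real.cosh u))) := by
    intro u
    have hu := Real.exp_pos u
    rw [abs_of_pos (by positivity), hg, ← ENNReal.ofReal_mul (by positivity)]
    congr 1
    have h1 : -(a * Real.exp u) - a ^ 2 / (a * Real.exp u) = -(2 * a) * Real.cosh u := by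
      rw [Real.cosh_eq, Real.exp_neg]
      field_simp
      ring
    rw [h1, mul_pow, Real.exp_nat_mul]
    field_simp
  have h1 : ∫⁻ s in Ioi a, g s =
      ∫⁻ t in Ioi (0 : ℝ), ENNReal.ofReal (a ^ κ * (Real.exp (κ * t) *
        Real.exp (-(2 * a) * Real.cosh t))) := by
    rw [← himg1, lintegral_image_eq_lintegral_abs_deriv_mul measurableSet_Ioi
      (f' := fun t => a * Real.exp t)
      (fun t _ => ((Real.hasDerivAt_exp t).const_mul a).hasDerivWithinAt)
      (fun t _ t' _ h => Real.exp_injective (mul_left_cancel₀ ha.ne' h))]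
    simp_rw [hcv]
  have h2 : ∫⁻ s in Ioc 0 a, g s =
      ∫⁻ t in Ioi (0 : ℝ), ENNReal.ofReal (a ^ κ * (Real.exp (-(κ * t)) *
        Real.exp (-(2 * a) * Real.cosh t))) := by
    rw [← himg2, lintegral_image_eq_lintegral_abs_deriv_mul measurableSet_Ici
      (f' := fun t => -(a * Real.exp (-t)))
      (fun t _ => ((((hasDerivAt_neg t).exp).const_mul a).congr_deriv (by ring)).hasDerivWithinAt)
      (fun t _ t' _ h => neg_injective (Real.exp_injective (mul_left_cancel₀ ha.ne' h)))]
    simp_rw [abs_neg, hcv, Real.cosh_neg, mul_neg]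
    exact setLIntegral_congr Ioi_ae_eq_Ici.symm
  have hunion : Ioi (0 : ℝ) = Ioc 0 a ∪ Ioi a := (Ioc_union_Ioi_eq_Ioi ha.le).symm
  rw [hunion, lintegral_union measurableSet_Ioi (Ioc_disjoint_Ioi le_rfl), h1, h2,
    ← lintegral_add_left (by fun_prop), besselKReal_eq, ← integral_const_mul, ← integral_const_mul,
    ofReal_integral_eq_lintegral_ofReal]
  · refine lintegral_congr fun t => ?_
    rw [← ENNReal.ofReal_add (by positivity) (by positivity), Real.cosh_eq (κ * t)]
    congr 1
    ring
  · exact ((integrableOn_besselK_integrand κ (by positivity)).const_mul _).const_mul _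
  · exact Eventually.of_forall fun t => by simp only [Pi.zero_apply]; positivity

/-- Insert the integral representation and exchange the integrals by Tonelli: the y-integral is a
Gamma integral giving m! (s/p)^{m+1}, and the s-integral another giving (m+κ)!. -/
theorem lintegral_pow_mul_besselK (κ m : ℕ) {p : ℝ} (hp : 0 < p) :
    ∫⁻ y in Ioi (0 : ℝ), ENNReal.ofReal (y ^ m) *
      ENNReal.ofReal (2 * (√(p * y) ^ κ * besselKReal κ (2 * √(p * y)))) =
      ENNReal.ofReal ((m ! : ℝ) * (m + κ)! / p ^ (m + 1)) := by
  have h1 : ∀ y ∈ Ioi (0 : ℝ), ENNReal.ofReal (y ^ m) *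
      ENNReal.ofReal (2 * (√(p * y) ^ κ * besselKReal κ (2 * √(p * y)))) =
      ∫⁻ s in Ioi (0 : ℝ), ENNReal.ofReal (y ^ m) *
        ENNReal.ofReal (s ^ κ / s * Real.exp (-s - p * y / s)) := by
    intro y (hy : 0 < y)
    rw [lintegral_const_mul _ (by fun_prop), ← lintegral_besselK_representation κ
      (Real.sqrt_pos.2 (mul_pos hp hy)), Real.sq_sqrt (mul_pos hp hy).le]
  rw [setLIntegral_congr_fun measurableSet_Ioi h1, lintegral_lintegral_swap
    (Measurable.aemeasurable (by fun_prop))]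
  have h2 : ∀ s ∈ Ioi (0 : ℝ), ∫⁻ y in Ioi (0 : ℝ), ENNReal.ofReal (y ^ m) *
        ENNReal.ofReal (s ^ κ / s * Real.exp (-s - p * y / s)) =
      ENNReal.ofReal ((m ! : ℝ) / p ^ (m + 1)) *
        ENNReal.ofReal (s ^ (m + κ) * Real.exp (-(1 * s))) := by
    intro s (hs : 0 < s)
    have h3 : ∀ y ∈ Ioi (0 : ℝ), ENNReal.ofReal (y ^ m) *
        ENNReal.ofReal (s ^ κ / s * Real.exp (-s - p * y / s)) =
        ENNReal.ofReal (s ^ κ / s * Real.exp (-s)) *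
          ENNReal.ofReal (y ^ m * Real.exp (-(p / s * y))) := by
      intro y (hy : 0 < y)
      rw [← ENNReal.ofReal_mul (by positivity), ← ENNReal.ofReal_mul (by positivity)]
      congr 1
      rw [show -s - p * y / s = -s + -(p / s * y) by ring, Real.exp_add]
      ring
    rw [setLIntegral_congr_fun measurableSet_Ioi h3, lintegral_const_mul _ (by fun_prop),
      lintegral_rpow_mul_exp_eq m (div_pos hp hs), ← ENNReal.ofReal_mul (by positivity),
      ← ENNReal.ofReal_mul (by positivity)]
    congr 1
    rw [one_mul, div_pow]
    field_simp
    ring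
  rw [setLIntegral_congr_fun measurableSet_Ioi h2, lintegral_const_mul _ (by fun_prop),
    lintegral_rpow_mul_exp_eq _ one_pos, ← ENNReal.ofReal_mul (by positivity)]
  congr 1
  rw [one_pow, div_one]
  ring

/-- The moments cancel the factorials of the power series, leaving the geometric series ∑ (d/p)^m /
(2p). All terms are nonnegative, so the exchange of sum and integral is free. -/
theorem lintegral_besselEntire_mul_besselK (κ : ℕ) {d p : ℝ} (hd : 0 ≤ d) (hdp : d < p) :
    ∫⁻ y in Ioi (0 : ℝ), ENNReal.ofReal (besselEntireReal κ (d * y) *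
      (√(p * y) ^ κ * besselKReal κ (2 * √(p * y)))) = ENNReal.ofReal (1 / (2 * (p - d))) := by
  have hp : 0 < p := hd.trans_lt hdp
  have h1 : ∀ y ∈ Ioi (0 : ℝ), ENNReal.ofReal (besselEntireReal κ (d * y) *
      (√(p * y) ^ κ * besselKReal κ (2 * √(p * y)))) =
      ∑' m : ℕ, ENNReal.ofReal (d ^ m / ((m ! : ℝ) * (m + κ)!) / 2) * (ENNReal.ofReal (y ^ m) *
        ENNReal.ofReal (2 * (√(p * y) ^ κ * besselKReal κ (2 * √(p * y))))) := by
    intro y (hy : 0 < y)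
    have hK := besselKReal_nonneg κ (2 * √(p * y))
    have hs := (summable_besselEntireReal κ (d * y)).mul_right
      (√(p * y) ^ κ * besselKReal κ (2 * √(p * y)))
    rw [besselEntireReal, ← tsum_mul_right, ENNReal.ofReal_tsum_of_nonneg
      (fun m => by positivity) hs]
    refine tsum_congr fun m => ?_
    rw [← ENNReal.ofReal_mul (by positivity), ← ENNReal.ofReal_mul (by positivity)]
    congr 1
    rw [mul_pow]
    ring
  have hmeas : ∀ m : ℕ, AEMeasurable (fun y : ℝ => ENNReal.ofReal (y ^ m) *
        ENNReal.ofReal (2 * (√(p * y) ^ κ * besselKReal κ (2 * √(p * y)))))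
        (volume.restrict (Ioi 0)) := by
    intro m
    refine AEMeasurable.mul (by fun_prop) (AEMeasurable.ennreal_ofReal
      (AEMeasurable.const_mul (AEMeasurable.mul (by fun_prop) ?_) 2))
    refine ContinuousOn.aemeasurable ((continuousOn_besselKReal κ).comp (by fun_prop)
      fun y (hy : 0 < y) => ?_) measurableSet_Ioi
    exact mul_pos two_pos (Real.sqrt_pos.2 (mul_pos hp hy))
  rw [setLIntegral_congr_fun measurableSet_Ioi h1, lintegral_tsum fun m => (hmeas m).const_mul _]
  have h2 : ∀ m : ℕ, ∫⁻ y in Ioi (0 : ℝ), ENNReal.ofReal (d ^ m / ((m ! : ℝ) * (m + κ)!) / 2) *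
      (ENNReal.ofReal (y ^ m) *
        ENNReal.ofReal (2 * (√(p * y) ^ κ * besselKReal κ (2 * √(p * y))))) =
      ENNReal.ofReal ((d / p) ^ m * (1 / (2 * p))) := by
    intro m
    rw [lintegral_const_mul'' _ (hmeas m), lintegral_pow_mul_besselK κ m hp,
      ← ENNReal.ofReal_mul (by positivity)]
    congr 1
    rw [div_pow]
    field_simp
    ring
  have hlt : d / p < 1 := (div_lt_one hp).2 hdp
  simp_rw [h2]
  rw [← ENNReal.ofReal_tsum_of_nonneg (fun m => by positivity)
    ((summable_geometric_of_lt_one (by positivity) hlt).mul_right _), tsum_mul_right,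
    tsum_geometric_of_lt_one (by positivity) hlt]
  congr 1
  have h3 : p - d ≠ 0 := (sub_pos.2 hdp).ne'
  have h4 : 1 - d / p ≠ 0 := (sub_pos.2 hlt).ne'
  field_simp

theorem besselEntireReal_nonneg (κ : ℕ) {x : ℝ} (hx : 0 ≤ x) : 0 ≤ besselEntireReal κ x :=
  tsum_nonneg fun m => by positivity

theorem integrableOn_besselEntire_mul_besselK (κ : ℕ) {d p : ℝ} (hd : 0 ≤ d) (hdp : d < p) :
    IntegrableOn (fun y => besselEntireReal κ (d * y) *
      (√(p * y) ^ κ * besselKReal κ (2 * √(p * y)))) (Ioi 0) ∧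
    ∫ y in Ioi (0 : ℝ), besselEntireReal κ (d * y) *
      (√(p * y) ^ κ * besselKReal κ (2 * √(p * y))) = 1 / (2 * (p - d)) := by
  have hp : 0 < p := hd.trans_lt hdp
  have hmeas : AEStronglyMeasurable (fun y => besselEntireReal κ (d * y) *
      (√(p * y) ^ κ * besselKReal κ (2 * √(p * y)))) (volume.restrict (Ioi 0)) := by
    refine ContinuousOn.aestronglyMeasurable (ContinuousOn.mul
      ((continuous_besselEntireReal κ).comp (by fun_prop)).continuousOn
      (ContinuousOn.mul (by fun_prop) ((continuousOn_besselKReal κ).comp (by fun_prop)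
        fun y (hy : 0 < y) => ?_))) measurableSet_Ioi
    exact mul_pos two_pos (Real.sqrt_pos.2 (mul_pos hp hy))
  have hnn : 0 ≤ᵐ[volume.restrict (Ioi 0)] fun y => besselEntireReal κ (d * y) *
      (√(p * y) ^ κ * besselKReal κ (2 * √(p * y))) := by
    filter_upwards [ae_restrict_mem measurableSet_Ioi] with y (hy : 0 < y)
    have h1 := besselKReal_nonneg κ (2 * √(p * y))
    have h2 := besselEntireReal_nonneg κ (x := d * y) (by positivity)
    simp only [Pi.zero_apply]
    positivity
  have h := lintegral_besselEntire_mul_besselK κ hd hdp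
  constructor
  · refine ⟨hmeas, ?_⟩
    rw [hasFiniteIntegral_iff_ofReal hnn, h]
    exact ENNReal.ofReal_lt_top
  · rw [integral_eq_lintegral_of_nonneg_ae hnn hmeas, h, ENNReal.toReal_ofReal]
    have := sub_pos.2 hdp
    positivity

end BesselMoments

/-! ### The ensemble: biorthogonal functions, density and kernel -/

section Ensemble

theorem Real.rpow_natCast_div_two (κ : ℕ) {x : ℝ} (hx : 0 ≤ x) :
    x ^ ((κ : ℝ) / 2) = √x ^ κ := by
  rw [Real.rpow_div_two_eq_sqrt _ hx, Real.rpow_natCast]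

/-- `δ^{-κ/2} ψ(y)`, which extends continuously to `δ = 0`. -/
noncomputable def psiRegular (κ : ℕ) (d y : ℝ) : ℝ := y ^ κ * besselEntireReal κ (d * y)

theorem psiFun_eq (κ : ℕ) {d y : ℝ} (hd : 0 ≤ d) (hy : 0 ≤ y) :
    psiFun κ d y = d ^ ((κ : ℝ) / 2) * psiRegular κ d y := by
  unfold psiFun psiRegular
  rw [besselIReal_two_mul, Real.sq_sqrt (mul_nonneg hd hy), Real.sqrt_mul hd, mul_pow,
    Real.rpow_natCast_div_two κ hd, Real.rpow_natCast_div_two κ hy]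
  nth_rw 4 [← Real.sq_sqrt hy]
  ring

/-- The identity y √(p/(αy)) = α⁻¹ √(αpy), raised to the power κ, lets the y^κ in `psiRegular` bring
φ into the form of the Bessel pairing. -/
theorem pow_mul_phiFun (κ : ℕ) {α p y : ℝ} (hα : 0 < α) (hp : 0 < p) (hy : 0 < y) :
    y ^ κ * phiFun κ α p y =
      (α ^ κ)⁻¹ * (√(α * p * y) ^ κ * besselKReal κ (2 * √(α * p * y))) := by
  unfold phiFun
  rw [Real.rpow_natCast_div_two κ (by positivity)]
  have h : y * √(p / (α * y)) = α⁻¹ * √(α * p * y) := by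
    rw [← Real.sqrt_sq hy.le, ← Real.sqrt_sq (inv_pos.2 hα).le, ← Real.sqrt_mul (by positivity),
      ← Real.sqrt_mul (by positivity), Real.sqrt_sq hy.le]
    congr 1
    field_simp
  rw [← mul_assoc, ← mul_pow, h, mul_pow, inv_pow]
  ring

theorem integrableOn_psiRegular_mul_phiFun (κ : ℕ) {α p d : ℝ} (hα : 0 < α) (hp : 0 < p)
    (hd : 0 ≤ d) (hdp : 0 < α * p - d) :
    IntegrableOn (fun y => psiRegular κ d y * phiFun κ α p y) (Ioi 0) ∧
    ∫ y in Ioi (0 : ℝ), psiRegular κ d y * phiFun κ α p y =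
      (2 * α ^ κ)⁻¹ * (α * p - d)⁻¹ := by
  obtain ⟨h1, h2⟩ := integrableOn_besselEntire_mul_besselK κ hd (sub_pos.1 hdp)
  have heq : EqOn (fun y => (α ^ κ)⁻¹ * (besselEntireReal κ (d * y) *
      (√(α * p * y) ^ κ * besselKReal κ (2 * √(α * p * y)))))
      (fun y => psiRegular κ d y * phiFun κ α p y) (Ioi 0) := by
    intro y (hy : 0 < y)
    have h := pow_mul_phiFun κ hα hp hy
    simp only [psiRegular]
    linear_combination (-besselEntireReal κ (d * y)) * h
  refine ⟨IntegrableOn.congr_fun (h1.const_mul _) heq measurableSet_Ioi, ?_⟩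
  rw [← setIntegral_congr_fun measurableSet_Ioi heq, integral_const_mul, h2]
  have := hdp.ne'
  field_simp

variable {κ ν N : ℕ} {α : ℝ} {q : Fin (ν + N) → ℝ} {δ : Fin N → ℝ}

/-- The function biorthogonal to `psiRegular`. -/
noncomputable def chiFun (κ : ℕ) (α : ℝ) (q : Fin (ν + N) → ℝ) (δ : Fin N → ℝ) (j : Fin N)
    (y : ℝ) : ℝ :=
  2 * α ^ κ * ∑ i, biorthCoeff (fun i => α * q i) δ j i * phiFun κ α (q i) y

theorem psiRegular_mul_chiFun (l j : Fin N) (y : ℝ) :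
    psiRegular κ (δ l) y * chiFun κ α q δ j y =
      ∑ i, 2 * α ^ κ * biorthCoeff (fun i => α * q i) δ j i *
        (psiRegular κ (δ l) y * phiFun κ α (q i) y) := by
  unfold chiFun
  rw [Finset.mul_sum, Finset.mul_sum]
  exact Finset.sum_congr rfl fun i _ => by ring

theorem integrableOn_psiRegular_mul_chiFun (hα : 0 < α) (hq : ∀ i, 0 < q i) (hδ : ∀ j, 0 ≤ δ j)
    (hqδ : ∀ i j, 0 < α * q i - δ j) (l j : Fin N) :
    IntegrableOn (fun y => psiRegular κ (δ l) y * chiFun κ α q δ j y) (Ioi 0) := by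
  simp_rw [psiRegular_mul_chiFun]
  exact integrable_finsetSum _ fun i _ =>
    (integrableOn_psiRegular_mul_phiFun κ hα (hq i) (hδ l) (hqδ i l)).1.const_mul _

theorem integral_psiRegular_mul_chiFun (hα : 0 < α) (hq : ∀ i, 0 < q i)
    (hq_inj : Function.Injective q) (hδ : ∀ j, 0 ≤ δ j) (hδ_inj : Function.Injective δ)
    (hqδ : ∀ i j, 0 < α * q i - δ j) (l j : Fin N) :
    ∫ y in Ioi (0 : ℝ), psiRegular κ (δ l) y * chiFun κ α q δ j y = if l = j then 1 else 0 := by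
  simp_rw [psiRegular_mul_chiFun]
  rw [integral_finsetSum _ fun i _ =>
    (integrableOn_psiRegular_mul_phiFun κ hα (hq i) (hδ l) (hqδ i l)).1.const_mul _]
  simp_rw [integral_const_mul]
  have h := sum_biorthCoeff_mul_inv_sub (x := fun i => α * q i) (d := δ)
    (fun a b h => hq_inj (mul_left_cancel₀ hα.ne' h)) hδ_inj
    (fun i j => (sub_pos.1 (hqδ i j)).ne') (Nat.le_add_left N ν) j l
  rw [if_congr (eq_comm (a := l)) rfl rfl, ← h]
  refine Finset.sum_congr rfl fun i _ => ?_
  rw [(integrableOn_psiRegular_mul_phiFun κ hα (hq i) (hδ l) (hqδ i l)).2]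
  have := (hqδ i l).ne'
  field_simp

/-- The density, with the common factor `∏ δ_j^{κ/2}` of numerator and denominator removed. -/
noncomputable def densityRegular (κ ν N : ℕ) (α : ℝ) (q : Fin (ν + N) → ℝ) (δ : Fin N → ℝ)
    (y : Fin N → ℝ) : ℝ :=
  2 ^ N * (N ! : ℝ) / ((N ! : ℝ) ^ 2 * (-α) ^ (N * ν + N * (N - 1) / 2) / α ^ (N * κ) *
    (vandermondeProd q * vandermondeProd δ) / ∏ i, ∏ j, (α * q i - δ j)) *
    (Matrix.of fun i j : Fin N => psiRegular κ (δ i) (y j)).det *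
    (powAppend ν q (Matrix.of fun i j => phiFun κ α (q i) (y j))).det

theorem densityFormula_eq_densityRegular (hδ : ∀ j, 0 ≤ δ j) (h : κ = 0 ∨ ∀ j, 0 < δ j)
    {y : Fin N → ℝ} (hy : ∀ j, 0 < y j) :
    densityFormula κ ν N α q δ y = densityRegular κ ν N α q δ y := by
  unfold densityFormula densityRegular normConst
  have hprod : ∏ j, δ j ^ ((κ : ℝ) / 2) ≠ 0 := by
    refine Finset.prod_ne_zero_iff.2 fun j _ => ?_
    rcases h with rfl | h
    · simp
    · exact (Real.rpow_pos_of_pos (h j) _).ne'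
  have hdet : (Matrix.of fun i j : Fin N => psiFun κ (δ i) (y j)).det =
      (∏ j, δ j ^ ((κ : ℝ) / 2)) *
        (Matrix.of fun i j : Fin N => psiRegular κ (δ i) (y j)).det := by
    rw [← Matrix.det_mul_column]
    congr 1
    ext i j
    exact psiFun_eq κ (hδ i) (hy j).le
  rw [hdet]
  have hpa : (Matrix.of fun i c : Fin (ν + N) => Fin.append (fun k : Fin ν => q i ^ (k : ℕ))
      (fun j : Fin N => phiFun κ α (q i) (y j)) c).det =
      (powAppend ν q (Matrix.of fun i j => phiFun κ α (q i) (y j))).det := rfl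
  rw [hpa]
  have key : ∀ C A V s P D E : ℝ, s ≠ 0 →
      C / (A * (V * s) / P) * (s * D) * E = C / (A * V / P) * D * E := by
    intro C A V s P D E hs
    field_simp
  exact key _ _ _ _ _ _ _ hprod

theorem continuousAt_densityRegular (hα : 0 < α) (hq_inj : Function.Injective q)
    (hδ_inj : Function.Injective δ) (hqδ : ∀ i j, 0 < α * q i - δ j) (y : Fin N → ℝ) :
    ContinuousAt (fun δ' => densityRegular κ ν N α q δ' y) δ := by
  unfold densityRegular
  have hP : ∏ i, ∏ j, (α * q i - δ j) ≠ 0 :=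
    Finset.prod_ne_zero_iff.2 fun i _ => Finset.prod_ne_zero_iff.2 fun j _ => (hqδ i j).ne'
  have hPc : Continuous fun δ' : Fin N → ℝ => ∏ i, ∏ j, (α * q i - δ' j) :=
    continuous_finsetProd _ fun i _ => continuous_finsetProd _ fun j _ => by fun_prop
  have hVc : Continuous fun δ' : Fin N → ℝ => vandermondeProd δ' := by
    unfold vandermondeProd
    fun_prop
  have hψ : Continuous fun δ' : Fin N → ℝ =>
      (Matrix.of fun i j : Fin N => psiRegular κ (δ' i) (y j)).det := by
    refine Continuous.matrix_det (continuous_matrix fun i j => ?_)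
    exact continuous_const.mul ((continuous_besselEntireReal κ).comp (by fun_prop))
  refine ContinuousAt.mul (ContinuousAt.mul (ContinuousAt.div continuousAt_const
    (ContinuousAt.div ?_ hPc.continuousAt hP) ?_) hψ.continuousAt) continuousAt_const
  · exact (continuous_const.mul (continuous_const.mul hVc)).continuousAt
  · have h1 := vandermondeProd_ne_zero hq_inj
    have h2 := vandermondeProd_ne_zero hδ_inj
    have h3 : (-α) ^ (N * ν + N * (N - 1) / 2) ≠ 0 := pow_ne_zero _ (neg_ne_zero.2 hα.ne')
    positivity

/-- At δ on the boundary of the positive orthant, the formula coincides with `densityRegular` along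
positive parameters, and `densityRegular` is continuous at δ because the parameters are distinct. -/
theorem jointDensity_eq_densityRegular (hα : 0 < α) (hq_inj : Function.Injective q)
    (hδ : ∀ j, 0 ≤ δ j) (hδ_inj : Function.Injective δ) (hqδ : ∀ i j, 0 < α * q i - δ j)
    {y : Fin N → ℝ} (hy : ∀ j, 0 < y j) :
    jointDensity κ ν N α q δ y = densityRegular κ ν N α q δ y := by
  unfold jointDensity
  split_ifs with h
  · exact densityFormula_eq_densityRegular hδ h hy
  · have hset : {δ' : Fin N → ℝ | ∀ j, 0 < δ' j} = Set.univ.pi fun _ => Ioi 0 := by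
      ext δ'
      simp
    have : (𝓝[{δ' : Fin N → ℝ | ∀ j, 0 < δ' j}] δ).NeBot := by
      rw [← mem_closure_iff_nhdsWithin_neBot, hset, closure_pi_set]
      intro j _
      rw [closure_Ioi]
      exact hδ j
    refine Tendsto.limUnder_eq (Tendsto.congr' ?_
      (continuousAt_densityRegular hα hq_inj hδ_inj hqδ y).continuousWithinAt)
    filter_upwards [self_mem_nhdsWithin] with δ' hδ'
    exact (densityFormula_eq_densityRegular (fun j => (hδ' j).le) (Or.inr hδ') hy).symm

theorem densityRegular_eq_kernelDet (hα : 0 < α) (hq_inj : Function.Injective q)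
    (hδ_inj : Function.Injective δ) (hqδ : ∀ i j, 0 < α * q i - δ j) (y : Fin N → ℝ) :
    densityRegular κ ν N α q δ y = (N ! : ℝ)⁻¹ *
      kernelDet (fun j => psiRegular κ (δ j)) (fun j => chiFun κ α q δ j) y := by
  have hxd : ∀ i j, α * q i ≠ δ j := fun i j => (sub_pos.1 (hqδ i j)).ne'
  have hP : ∏ i, ∏ j, (α * q i - δ j) ≠ 0 :=
    Finset.prod_ne_zero_iff.2 fun i _ => Finset.prod_ne_zero_iff.2 fun j _ => (hqδ i j).ne'
  have hx : Function.Injective fun i => α * q i :=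
    fun a b h => hq_inj (mul_left_cancel₀ hα.ne' h)
  have h1 := vandermondeProd_ne_zero hq_inj
  have h2 := vandermondeProd_ne_zero hδ_inj
  have h3 : (-α) ^ (N * ν + N * (N - 1) / 2) ≠ 0 := pow_ne_zero _ (neg_ne_zero.2 hα.ne')
  have hD := det_powAppend_cauchy hα hδ_inj hxd
  have hdet := det_powAppend_eq_mul_det (q := q)
    (G := Matrix.of fun i j => (α * q i - δ j)⁻¹)
    (Φ := Matrix.of fun i j => phiFun κ α (q i) (y j))
    (C := Matrix.of fun j i => biorthCoeff (fun i => α * q i) δ j i)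
    (fun j k => by
      -- The coefficients belong to the nodes α q_i, while the columns contain powers of q_i; the
      -- factor α^k is divided out.
      have h := sum_biorthCoeff_mul_pow (d := δ) hx j (k := k) (by have := k.2; lia)
      simp_rw [mul_pow, mul_left_comm _ (α ^ (k : ℕ))] at h
      rw [← Finset.mul_sum] at h
      exact (mul_eq_zero.1 h).resolve_left (pow_ne_zero _ hα.ne'))
    (by
      ext j l
      rw [Matrix.mul_apply, Matrix.one_apply]
      exact sum_biorthCoeff_mul_inv_sub hx hδ_inj hxd (Nat.le_add_left N ν) j l)
    (by
      rw [hD]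
      exact div_ne_zero (mul_ne_zero h3 (mul_ne_zero h1 h2)) hP)
  have hK : kernelDet (fun j => psiRegular κ (δ j)) (fun j => chiFun κ α q δ j) y =
      (Matrix.of fun i j : Fin N => psiRegular κ (δ i) (y j)).det *
        ((2 * α ^ κ) ^ N *
          ((Matrix.of fun j i => biorthCoeff (fun i => α * q i) δ j i) *
            (Matrix.of fun i j => phiFun κ α (q i) (y j))).det) := by
    have hs : (2 * α ^ κ) ^ N = (2 * α ^ κ) ^ Fintype.card (Fin N) := by rw [Fintype.card_fin]
    rw [hs, ← Matrix.det_smul, ← Matrix.det_transpose, ← Matrix.det_mul]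
    unfold kernelDet sumKernel
    congr 1
  unfold densityRegular
  rw [hdet, hD, hK, mul_pow, ← pow_mul, mul_comm κ N]
  generalize ∏ i, ∏ j, (α * q i - δ j) = R at hP
  field_simp

/-! ### The contour kernel -/

variable {γδ γq : ℝ → ℂ}

theorem kernelIntegrand_eq {η : ℂ} (hη : η ≠ 0) {y₁ : ℝ} (hy₁ : 0 < y₁) (y₂ : ℝ) (ζ : ℂ) :
    kernelIntegrand κ ν N α q δ y₁ y₂ η ζ =
      ((y₁ : ℂ) ^ ((κ : ℂ) / 2) * besselEntire κ (η * y₁)) *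
        (ζ ^ ((κ : ℂ) / 2) * besselK κ (2 * (ζ * y₂) ^ (1 / 2 : ℂ))) / (η - ζ) *
        (∏ l, (ζ - δ l) / (η - δ l)) * ∏ l, (η - α * q l) / (ζ - α * q l) := by
  unfold kernelIntegrand
  rw [besselI_two_mul_cpow κ hη hy₁]
  have h : η ^ ((κ : ℂ) / 2) ≠ 0 := by simp [Complex.cpow_eq_zero_iff, hη]
  congr 2
  field_simp

theorem differentiable_besselEntire_mul (κ : ℕ) (y : ℝ) :
    Differentiable ℂ fun η : ℂ => (y : ℂ) ^ ((κ : ℂ) / 2) * besselEntire κ (η * y) :=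
  ((differentiable_besselEntire κ).comp (by fun_prop)).const_mul _

theorem integrableOn_kernelIntegrand (hγδ : IsClosedContour γδ) (hγq : IsClosedContour γq)
    (hγδ_enc : ∀ j, (δ j : ℂ) ∉ contourImage γδ)
    (hγq_enc : ∀ i, ((α * q i : ℝ) : ℂ) ∉ contourImage γq)
    (hγq_slit : contourImage γq ⊆ Complex.slitPlane)
    (hdisj : Disjoint (contourImage γδ) (contourImage γq))
    {y₁ y₂ : ℝ} (hy₁ : 0 < y₁) (hy₂ : 0 < y₂) :
    IntegrableOn (fun p : ℝ × ℝ =>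
      kernelIntegrand κ ν N α q δ y₁ y₂ (γδ p.1) (γq p.2) * deriv γδ p.1 * deriv γq p.2)
      (Icc 0 1 ×ˢ Icc 0 1) := by
  have h := integrableOn_contour_prod hγδ hγq (G := fun η ζ =>
    ((y₁ : ℂ) ^ ((κ : ℂ) / 2) * besselEntire κ (η * y₁)) *
        (ζ ^ ((κ : ℂ) / 2) * besselK κ (2 * (ζ * y₂) ^ (1 / 2 : ℂ))) / (η - ζ) *
        (∏ l, (ζ - δ l) / (η - δ l)) * ∏ l, (η - α * q l) / (ζ - α * q l)) (by
    refine ContinuousOn.mul (ContinuousOn.mul (ContinuousOn.div (ContinuousOn.mul ?_ ?_)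
      (by fun_prop) ?_) ?_) ?_
    · exact ((differentiable_besselEntire_mul κ y₁).continuous.comp continuous_fst).continuousOn
    · exact (differentiableOn_cpow_mul_besselK κ hy₂).continuousOn.comp continuousOn_snd
        fun p hp => hγq_slit hp.2
    · exact fun p hp => sub_ne_zero.2 fun h => Set.disjoint_left.1 hdisj hp.1 (h ▸ hp.2)
    · exact continuousOn_finsetProd _ fun l _ => ContinuousOn.div (by fun_prop) (by fun_prop)
        fun p hp => sub_ne_zero.2 (ne_of_mem_of_not_mem hp.1 (hγδ_enc l))
    · refine continuousOn_finsetProd _ fun l _ => ContinuousOn.div (by fun_prop) (by fun_prop)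
        fun p hp => sub_ne_zero.2 (ne_of_mem_of_not_mem hp.2 ?_)
      simpa using hγq_enc l)
  -- At η = 0 with κ > 0 the principal-power formula divides by zero and need not agree with its
  -- analytic extension. A contour through 0 is harmless, since its derivative vanishes almost
  -- everywhere there.
  refine Integrable.congr h (ae_restrict_of_ae ?_)
  have hae : ∀ᵐ p : ℝ × ℝ, γδ p.1 = 0 → deriv γδ p.1 = 0 :=
    Measure.quasiMeasurePreserving_fst.ae (ae_deriv_eq_zero_of_eq γδ 0)
  filter_upwards [hae] with p hp
  by_cases hp0 : γδ p.1 = 0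
  · rw [hp hp0]
    simp
  · rw [kernelIntegrand_eq hp0 hy₁]

/-- The residue sum carries the coefficients `biorthCoeff` at the nodes α q_i. Writing its values
through `psiRegular` and `phiFun` supplies the constants of `chiFun` and leaves a conjugation by
y^{κ/2}. -/
theorem contourKernel_eq (hN : 0 < N) (hα : 0 < α) (hq : ∀ i, 0 < q i)
    (hq_inj : Function.Injective q) (hδ_inj : Function.Injective δ)
    (hγδ : IsClosedContour γδ) (hγq : IsClosedContour γq)
    (hγδ_enc : ∀ j, Encircles γδ (δ j : ℂ))
    (hγq_enc : ∀ i, Encircles γq ((α * q i : ℝ) : ℂ))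
    (hγq_slit : contourImage γq ⊆ Complex.slitPlane)
    (hdisj : Disjoint (contourImage γδ) (contourImage γq))
    {y₁ y₂ : ℝ} (hy₁ : 0 < y₁) (hy₂ : 0 < y₂) :
    contourKernel κ ν N α q δ γδ γq y₁ y₂ =
      (((√y₁ ^ κ)⁻¹ * (√y₂ ^ κ * sumKernel (fun j => psiRegular κ (δ j))
        (fun j => chiFun κ α q δ j) y₁ y₂) : ℝ) : ℂ) := by
  unfold contourKernel
  rw [contourIntegral_congr_of_ne (γ := γδ) (g := fun η => contourIntegral (fun ζ =>
      ((y₁ : ℂ) ^ ((κ : ℂ) / 2) * besselEntire κ (η * y₁)) *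
        (ζ ^ ((κ : ℂ) / 2) * besselK κ (2 * (ζ * y₂) ^ (1 / 2 : ℂ))) / (η - ζ) *
        (∏ l, (ζ - δ l) / (η - δ l)) * ∏ l, (η - α * q l) / (ζ - α * q l)) γq /
      (2 * Real.pi * Complex.I)) 0 fun η _ hη => by
    simp_rw [kernelIntegrand_eq hη hy₁]]
  have hxc : ∀ i, ((α * q i : ℝ) : ℂ) = α * q i := fun i => by push_cast; rfl
  simp only [hxc] at hγq_enc
  rw [contourIntegral_contourIntegral_eq_sum hN (Nat.add_pos_right ν hN) hγδ hγq
    (x := fun i => (α : ℂ) * q i) (d := fun j => (δ j : ℂ))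
    (fun a b (h : (α : ℂ) * q a = α * q b) =>
      hq_inj (mul_left_cancel₀ hα.ne' (by exact_mod_cast h)))
    (fun a b h => hδ_inj (Complex.ofReal_injective h))
    (fun i => by
      rw [← hxc]
      exact Complex.ofReal_mem_slitPlane.2 (mul_pos hα (hq i)))
    hγδ_enc hγq_enc hγq_slit hdisj (differentiable_besselEntire_mul κ y₁)
    (differentiableOn_cpow_mul_besselK κ hy₂)]
  have hcpow : ∀ {x : ℝ}, 0 ≤ x → (x : ℂ) ^ ((κ : ℂ) / 2) = ((√x ^ κ : ℝ) : ℂ) := by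
    intro x hx
    rw [← Real.rpow_natCast_div_two κ hx, Complex.ofReal_cpow hx]
    push_cast
    rfl
  have hA : ∀ j, (y₁ : ℂ) ^ ((κ : ℂ) / 2) * besselEntire κ (δ j * y₁) =
      (((√y₁ ^ κ)⁻¹ * psiRegular κ (δ j) y₁ : ℝ) : ℂ) := by
    intro j
    rw [hcpow hy₁.le, ← Complex.ofReal_mul, ← ofReal_besselEntireReal, ← Complex.ofReal_mul]
    congr 1
    unfold psiRegular
    have h1 : y₁ ^ κ = √y₁ ^ κ * √y₁ ^ κ := by
      rw [← mul_pow, Real.mul_self_sqrt hy₁.le]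
    have h2 : √y₁ ^ κ ≠ 0 := pow_ne_zero _ (Real.sqrt_pos.2 hy₁).ne'
    rw [h1]
    field_simp
  have hB : ∀ i, ((α : ℂ) * q i) ^ ((κ : ℂ) / 2) *
      besselK κ (2 * ((α : ℂ) * q i * y₂) ^ (1 / 2 : ℂ)) =
      ((α ^ κ * (√y₂ ^ κ * phiFun κ α (q i) y₂) : ℝ) : ℂ) := by
    intro i
    have hx : 0 ≤ α * q i := (mul_pos hα (hq i)).le
    have hxy : 0 ≤ α * q i * y₂ := mul_nonneg hx hy₂.le
    have hsqrt : ((α : ℂ) * q i * y₂) ^ (1 / 2 : ℂ) = ((√(α * q i * y₂) : ℝ) : ℂ) := by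
      rw [Real.sqrt_eq_rpow, Complex.ofReal_cpow hxy]
      push_cast
      rfl
    have htwo : (2 : ℂ) = ((2 : ℝ) : ℂ) := by norm_num
    rw [hsqrt, ← hxc, hcpow hx, htwo, ← Complex.ofReal_mul, ← ofReal_besselKReal,
      ← Complex.ofReal_mul]
    congr 1
    have h := pow_mul_phiFun κ hα (hq i) hy₂
    have h1 : y₂ ^ κ = √y₂ ^ κ * √y₂ ^ κ := by
      rw [← mul_pow, Real.mul_self_sqrt hy₂.le]
    have h2 : √y₂ ^ κ ≠ 0 := pow_ne_zero _ (Real.sqrt_pos.2 hy₂).ne'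
    rw [Real.sqrt_mul hx, mul_pow, h1] at h
    rw [Real.sqrt_mul hx]
    generalize besselKReal κ (2 * (√(α * q i) * √y₂)) = b at h ⊢
    field_simp at h
    linear_combination -h
  simp only [hA, hB]
  rw [Finset.sum_comm]
  unfold sumKernel chiFun biorthCoeff
  push_cast
  simp only [Finset.mul_sum]
  refine Finset.sum_congr rfl fun j _ => Finset.sum_congr rfl fun i _ => ?_
  ring

end Ensemble

/-! ### The correlation kernel of the ensemble -/

theorem theorem2 (κ ν N : ℕ) (α : ℝ) (hα : 0 < α)
    (q : Fin (ν + N) → ℝ) (hq : ∀ i, 0 < q i) (hq_inj : Function.Injective q)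
    (δ : Fin N → ℝ) (hδ : ∀ j, 0 ≤ δ j) (hδ_inj : Function.Injective δ)
    (hqδ : ∀ i j, 0 < α * q i - δ j)
    (γδ γq : ℝ → ℂ) (hγδ : IsClosedContour γδ) (hγq : IsClosedContour γq)
    (hγδ_enc : ∀ j, Encircles γδ (δ j : ℂ))
    (hγq_enc : ∀ i, Encircles γq ((α * q i : ℝ) : ℂ))
    (hγq_slit : contourImage γq ⊆ Complex.slitPlane)
    (hdisj : Disjoint (contourImage γδ) (contourImage γq)) :
    (∀ y₁ y₂ : ℝ, 0 < y₁ → 0 < y₂ →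
      IntegrableOn (fun p : ℝ × ℝ =>
        kernelIntegrand κ ν N α q δ y₁ y₂ (γδ p.1) (γq p.2) * deriv γδ p.1 * deriv γq p.2)
        (Icc 0 1 ×ˢ Icc 0 1)) ∧
    IsCorrelationKernel (jointDensity κ ν N α q δ) (contourKernel κ ν N α q δ γδ γq) := by
  refine ⟨fun y₁ y₂ hy₁ hy₂ => integrableOn_kernelIntegrand hγδ hγq (fun j => (hγδ_enc j).1)
    (fun i => (hγq_enc i).1) hγq_slit hdisj hy₁ hy₂, fun k hk y hy => ?_⟩
  obtain ⟨h1, h2⟩ := correlationFunction_eq_kernelDet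
    (ψ := fun j => psiRegular κ (δ j)) (χ := fun j => chiFun κ α q δ j)
    (integrableOn_psiRegular_mul_chiFun hα hq hδ hqδ)
    (integral_psiRegular_mul_chiFun hα hq hq_inj hδ hδ_inj hqδ)
    (P := jointDensity κ ν N α q δ)
    (fun z hz => by
      rw [jointDensity_eq_densityRegular hα hq_inj hδ hδ_inj hqδ hz,
        densityRegular_eq_kernelDet hα hq_inj hδ_inj hqδ])
    k hk y hy
  refine ⟨h1, ?_⟩
  have hK : (Matrix.of fun i j : Fin k => contourKernel κ ν N α q δ γδ γq (y i) (y j)) =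
      (Matrix.of fun i j : Fin k => (√(y i) ^ κ)⁻¹ * (Matrix.of fun i j => √(y j) ^ κ *
        sumKernel (fun j => psiRegular κ (δ j)) (fun j => chiFun κ α q δ j) (y i) (y j)) i j).map
          Complex.ofRealHom := by
    ext i j
    simp only [Matrix.of_apply, Matrix.map_apply, Complex.ofRealHom_eq_coe]
    -- The index `i` itself shows k > 0, hence N > 0; for k = 0 there are no matrix entries to
    -- compute.
    rw [contourKernel_eq (i.pos.trans_le hk) hα hq hq_inj hδ_inj hγδ hγq hγδ_enc hγq_enc hγq_slit
      hdisj (hy i) (hy j)]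
  have hdet := RingHom.map_det Complex.ofRealHom
    (Matrix.of fun i j : Fin k => (√(y i) ^ κ)⁻¹ * (Matrix.of fun i j => √(y j) ^ κ *
        sumKernel (fun j => psiRegular κ (δ j)) (fun j => chiFun κ α q δ j) (y i) (y j)) i j)
  rw [RingHom.mapMatrix_apply] at hdet
  rw [h2, hK, ← hdet, Complex.ofRealHom_eq_coe, Matrix.det_mul_column]
  have hrow := Matrix.det_mul_row (fun j : Fin k => √(y j) ^ κ) (Matrix.of fun i j => sumKernel
    (fun j => psiRegular κ (δ j)) (fun j => chiFun κ α q δ j) (y i) (y j))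
  simp only [Matrix.of_apply] at hrow
  -- The row factors y_i^{-κ/2} and the column factors y_j^{κ/2} multiply to 1.
  rw [hrow, ← mul_assoc, ← Finset.prod_mul_distrib, Finset.prod_eq_one fun i _ =>
    inv_mul_cancel₀ (pow_ne_zero κ (Real.sqrt_pos.2 (hy i)).ne'), one_mul]
  rfl
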